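/- For integers $\ell\ge 1$ and $n\ge 0$, call a partition $\ell$-regular if none of its parts is divisible by $\ell$, and let $T_\ell(n)$ be the number of $\ell$-regular partition triples of $n$, i.e. of ordered triples of $\ell$-regular partitions whose sizes add up to $n$; equivalently $\sum_{n\ge 0}T_\ell(n)q^n=\prod_{m\ge 1}\frac{(1-q^{\ell m})^3}{(1-q^m)^3}$. **Theorem.** For all integers $n,\alpha,\beta\ge 0$, $$T_{3^{2\alpha+1}}\!\left(3^{2\alpha+2\beta+1}n+\frac{2\cdot 3^{2\alpha+2\beta+2}-3^{2\alpha+1}+1}{8}\right)\equiv 0\pmod{3^{3\alpha+2\beta+2}},$$ $$T_{3^{2\alpha+1}}\!\left(3^{2\alpha+2\beta+2}n+\frac{14\cdot 3^{2\alpha+2\beta+1}-3^{2\alpha+1}+1}{8}\right)\equiv 0\pmod{3^{3\alpha+2\beta+4}},$$ $$T_{3^{2\alpha+1}}\!\left(3^{2\alpha+2\beta+2}n+\frac{22\cdot 3^{2\alpha+2\beta+1}-3^{2\alpha+1}+1}{8}\right)\equiv 0\pmod{3^{3\alpha+2\beta+5}}.$$ Moreover, for all integers $n,\alpha,\beta,k\ge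 0$ and every prime $p\equiv 3\pmod 4$ with $p\nmid n$, $$T_{3^{2\alpha+1}}\!\left(3^{2\alpha+2\beta+2}p^{2k+1}n+\frac{2p^{2k+2}\cdot 3^{2\alpha+2\beta+2}-3^{2\alpha+1}+1}{8}\right)\equiv 0\pmod{3^{3\alpha+2\beta+4}}.$$ (The first congruence, with $\alpha=a-1$ and $\beta=b$, is the conjecture of Baruah and Das that $T_{3^{2a-1}}\big(3^{2a+2b-1}n+\tfrac{2\cdot 3^{2a+2b}-3^{2a-1}+1}{8}\big)\equiv 0 \pmod{3^{3a+2b-1}}$ for all $b,n\ge 0$ and $a\ge 1$.) -/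

import Mathlib

/-- The finite set of `ℓ`-regular partition triples of `n`: ordered triples of partitions, of
sizes `s 0`, `s 1`, `s 2` with `s 0 + s 1 + s 2 = n`, such that no part of any of the three
partitions is divisible by `ℓ`. -/
def regularPartitionTriples (ℓ n : ℕ) :
    Finset (Σ s : Fin 3 → ℕ, ∀ i : Fin 3, Nat.Partition (s i)) :=
  (Finset.Nat.antidiagonalTuple 3 n).sigma fun s =>
    Fintype.piFinset fun i => Nat.Partition.restricted (s i) (fun m => ¬ ℓ ∣ m)

/-- `T ℓ n` is the number of `ℓ`-regular partition triples of `n`. -/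
def T (ℓ n : ℕ) : ℕ := (regularPartitionTriples ℓ n).card

open PowerSeries

/-! ### Substituting `X ^ 3` and selecting residue classes of exponents -/

/-! Write f(q) for Euler's product (`euler`). The generating function of T at ℓ = 3^(2α+1) is
f(q^ℓ)^3 / f(q)^3, and the progressions in the theorem come from repeatedly selecting exponents in a
class mod 3. Set ξ = q f(q^9)^3 / f(q)^3 (`etaNine`) and t = q f(q^3)^12 / f(q)^12 (`etaThree`).
Jacobi's identity dissects f^3 mod 3, and its norm over the cube roots of unity gives the modular
equation ξ^3 = t(q^3)(1 + 9ξ + 27ξ^2) (`etaNine_pow_three`). Hence `slice 0` sends each power of ξ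
to a polynomial in t whose j-th coefficient has 3-adic valuation growing like 9j/2
(`slice_zero_etaNine_pow_mem`). Since t(q^3) t = ξ^4, the same control holds for powers of t.

The first selection produces 9t. Each of α double selections gains a factor 3^3
(`shiftSliceZero_iterate`) and each of β further ones gains 3^2 (`shiftSliceOne_iterate`). With c =
3α + 2β + 2, the outcome is f^3 / f(q^3)^3 times a member of `oddSpan c`, which gives the first
congruence.

Modulo 3^(c+4) that member is a multiple of 3^c t, so the series becomes a multiple of 3^c q
f(q^3)^9 / f^9. The dissection of 1/f^9 supplies the extra 3^2 and 3^3 of the second and third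
congruences. In the remaining class the series is, modulo 3^(c+2), a multiple of 3^c f^6. By Jacobi,
f^6 lives on exponents m with 8m + 2 a sum of two squares, and a prime p ≡ 3 mod 4 dividing 8m + 2
to an odd power rules this out. -/

/-- The substitution `X ↦ X ^ 3`. -/
noncomputable def cube : ℤ⟦X⟧ →ₐ[ℤ] ℤ⟦X⟧ := PowerSeries.expand 3 three_ne_zero

/-- The power series `∑ a (3 * n + r) X ^ n` attached to `∑ a n X ^ n`. -/
noncomputable def slice (r : ℕ) : ℤ⟦X⟧ →ₗ[ℤ] ℤ⟦X⟧ where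
  toFun F := PowerSeries.mk fun n => coeff (3 * n + r) F
  map_add' F G := by ext n; simp
  map_smul' c F := by ext n; simp only [coeff_mk, map_zsmul, RingHom.id_apply]

@[simp] lemma coeff_slice (r n : ℕ) (F : ℤ⟦X⟧) : coeff n (slice r F) = coeff (3 * n + r) F := by
  simp [slice]

lemma coeff_cube_mul (n : ℕ) (F : ℤ⟦X⟧) : coeff (3 * n) (cube F) = coeff n F :=
  coeff_expand_mul 3 three_ne_zero F n

lemma coeff_cube_of_not_dvd {n : ℕ} (h : ¬ 3 ∣ n) (F : ℤ⟦X⟧) : coeff n (cube F) = 0 :=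
  coeff_expand_of_not_dvd 3 three_ne_zero F h

lemma cube_X : cube X = X ^ 3 := expand_X 3 three_ne_zero

lemma cube_injective : Function.Injective cube := fun F G h => by
  ext n
  rw [← coeff_cube_mul, h, coeff_cube_mul]

lemma slice_X_pow_mul_cube (r j : ℕ) (hr : r < 3) (hj : j < 3) (F : ℤ⟦X⟧) :
    slice r (X ^ j * cube F) = if j = r then F else 0 := by
  ext n
  rw [coeff_slice, coeff_X_pow_mul']
  split_ifs with h1 h2 h2
  · rw [h2, Nat.add_sub_cancel, coeff_cube_mul]
  · rw [coeff_cube_of_not_dvd (by omega)]; simp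
  · omega
  · simp

lemma eq_sum_cube_slice (F : ℤ⟦X⟧) :
    F = cube (slice 0 F) + X * cube (slice 1 F) + X ^ 2 * cube (slice 2 F) := by
  ext n
  have h1 : ∀ G : ℤ⟦X⟧, X * G = X ^ 1 * G := fun G => by rw [pow_one]
  rw [map_add, map_add, h1, coeff_X_pow_mul', coeff_X_pow_mul']
  obtain ⟨m, h | h | h⟩ : ∃ m, n = 3 * m ∨ n = 3 * m + 1 ∨ n = 3 * m + 2 := ⟨n / 3, by omega⟩
  · rw [h, coeff_cube_mul]
    split_ifs
    · rw [coeff_cube_of_not_dvd (by omega), coeff_cube_of_not_dvd (by omega)]; simp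
    · rw [coeff_cube_of_not_dvd (by omega)]; simp
    · omega
    · simp
  · rw [h, coeff_cube_of_not_dvd (by omega), if_pos (by omega), Nat.add_sub_cancel, coeff_cube_mul]
    split_ifs
    · rw [coeff_cube_of_not_dvd (by omega)]; simp
    · simp
  · rw [h, coeff_cube_of_not_dvd (by omega), if_pos (by omega), if_pos (by omega),
      coeff_cube_of_not_dvd (by omega), Nat.add_sub_cancel, coeff_cube_mul]
    simp

lemma slice_sum_cube {r : ℕ} (hr : r < 3) (F₀ F₁ F₂ : ℤ⟦X⟧) :
    slice r (cube F₀ + X * cube F₁ + X ^ 2 * cube F₂) =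
      if r = 0 then F₀ else if r = 1 then F₁ else F₂ := by
  have h0 := slice_X_pow_mul_cube r 0 hr (by norm_num) F₀
  have h1 := slice_X_pow_mul_cube r 1 hr (by norm_num) F₁
  have h2 := slice_X_pow_mul_cube r 2 hr (by norm_num) F₂
  rw [pow_zero, one_mul] at h0
  rw [pow_one] at h1
  rw [map_add, map_add, h0, h1, h2]
  interval_cases r <;> simp

/-- Series in X^3 act as scalars for residue selection; every later computation pulls such factors
out first. -/
lemma slice_cube_mul {r : ℕ} (hr : r < 3) (H F : ℤ⟦X⟧) :
    slice r (cube H * F) = H * slice r F := by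
  have h : cube H * F = cube (H * slice 0 F) + X * cube (H * slice 1 F)
      + X ^ 2 * cube (H * slice 2 F) := by
    conv_lhs => rw [eq_sum_cube_slice F]
    simp only [map_mul]
    ring
  rw [h, slice_sum_cube hr]
  interval_cases r <;> simp

lemma slice_succ_X_mul (r : ℕ) (F : ℤ⟦X⟧) : slice (r + 1) (X * F) = slice r F := by
  ext n
  rw [coeff_slice, ← add_assoc, coeff_succ_X_mul, coeff_slice]

/-! ### The Euler product -/

/-- The finite product `∏ (1 - X ^ i)` over `1 ≤ i ≤ n`. -/
noncomputable def eulerPoly (R : Type*) [CommRing R] (n : ℕ) : R⟦X⟧ :=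
  ∏ i ∈ Finset.range n, (1 - X ^ (i + 1))

lemma eulerPoly_succ (R : Type*) [CommRing R] (n : ℕ) :
    eulerPoly R (n + 1) = eulerPoly R n * (1 - X ^ (n + 1)) :=
  Finset.prod_range_succ _ _

@[simp] lemma eulerPoly_zero (R : Type*) [CommRing R] : eulerPoly R 0 = 1 := rfl

open scoped PowerSeries.WithPiTopology in
/-- Euler's product `∏ (1 - X ^ i)` over `i ≥ 1`. -/
noncomputable def euler : ℤ⟦X⟧ := ∏' i : ℕ, (1 - X ^ (i + 1))

lemma X_pow_dvd_eulerPoly_add_sub (R : Type*) [CommRing R] (m k : ℕ) :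
    (X : R⟦X⟧) ^ (m + 1) ∣ eulerPoly R (m + k) - eulerPoly R m := by
  induction k with
  | zero => simp
  | succ k ih =>
    rw [← add_assoc, eulerPoly_succ]
    have h : (X : R⟦X⟧) ^ (m + 1) ∣ X ^ (m + k + 1) := pow_dvd_pow _ (by omega)
    have := dvd_sub ih (h.mul_left (eulerPoly R (m + k)))
    convert! this using 1
    ring

lemma X_pow_dvd_euler_sub (m : ℕ) : (X : ℤ⟦X⟧) ^ (m + 1) ∣ euler - eulerPoly ℤ m := by
  rw [X_pow_dvd_iff]
  intro d hd
  open scoped PowerSeries.WithPiTopology in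
  have h : HasProd (fun i : ℕ => (1 - X ^ (i + 1) : ℤ⟦X⟧)) euler :=
    (WithPiTopology.multipliable_one_sub_X_pow ℤ).hasProd
  have h2 := (WithPiTopology.tendsto_iff_coeff_tendsto ℤ _ _ _).1 h.tendsto_prod_nat d
  rw [nhds_discrete, Filter.tendsto_pure, Filter.eventually_atTop] at h2
  obtain ⟨N, hN⟩ := h2
  have h3 := hN (m + N) (by omega)
  have h4 := X_pow_dvd_iff.1 (X_pow_dvd_eulerPoly_add_sub ℤ m N) d hd
  rw [map_sub, sub_eq_zero] at h4
  rw [map_sub, ← h3, sub_eq_zero]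
  exact h4

lemma eq_of_forall_X_pow_dvd_sub {R : Type*} [CommRing R] {F G : R⟦X⟧}
    (h : ∀ n : ℕ, X ^ n ∣ F - G) : F = G := by
  ext n
  have := X_pow_dvd_iff.1 (h (n + 1)) n (by omega)
  rwa [map_sub, sub_eq_zero] at this

lemma constantCoeff_euler : constantCoeff euler = 1 := by
  have := X_pow_dvd_iff.1 (X_pow_dvd_euler_sub 0) 0 (by omega)
  simpa [sub_eq_zero] using this

/-- The inverse of Euler's product: the generating function of partitions. -/
noncomputable def eulerInv : ℤ⟦X⟧ := invOfUnit euler 1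

lemma euler_mul_eulerInv : euler * eulerInv = 1 :=
  mul_invOfUnit _ _ (by rw [constantCoeff_euler, Units.val_one])

lemma euler_ne_zero : euler ≠ 0 :=
  left_ne_zero_of_mul (by rw [euler_mul_eulerInv]; exact one_ne_zero)

/-! ### Jacobi's identity for the cube of the Euler product -/

/-- The inverse of `eulerPoly ℤ m`, extended by zero to negative `m`. -/
noncomputable def eulerPolyInv (m : ℤ) : ℤ⟦X⟧ :=
  if 0 ≤ m then invOfUnit (eulerPoly ℤ m.toNat) 1 else 0

lemma constantCoeff_eulerPoly (m : ℕ) : constantCoeff (eulerPoly ℤ m) = 1 := by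
  simp [eulerPoly, map_prod]

lemma eulerPoly_mul_eulerPolyInv (m : ℕ) : eulerPoly ℤ m * eulerPolyInv m = 1 := by
  rw [eulerPolyInv, if_pos (by positivity), Int.toNat_natCast]
  exact mul_invOfUnit _ _ (by rw [constantCoeff_eulerPoly, Units.val_one])

lemma eulerPolyInv_of_neg {m : ℤ} (hm : m < 0) : eulerPolyInv m = 0 := by
  rw [eulerPolyInv, if_neg (by omega)]

lemma eulerPolyInv_succ (m : ℕ) :
    eulerPolyInv m = eulerPolyInv (m + 1 : ℕ) * (1 - X ^ (m + 1)) := by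
  have h1 := eulerPoly_mul_eulerPolyInv m
  have h2 := eulerPoly_mul_eulerPolyInv (m + 1)
  rw [eulerPoly_succ] at h2
  linear_combination (-eulerPolyInv m) * h2 +
    (eulerPolyInv (m + 1 : ℕ) * (1 - X ^ (m + 1))) * h1

lemma eulerPolyInv_sub_one (m : ℕ) :
    eulerPolyInv (m - 1) = eulerPolyInv m * (1 - X ^ m) := by
  cases m with
  | zero => rw [eulerPolyInv_of_neg (by norm_num)]; simp
  | succ m => rw [← eulerPolyInv_succ]; congr 1; push_cast; ring

lemma eulerPolyInv_sub_two (m : ℕ) :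
    X * eulerPolyInv (m - 2) = eulerPolyInv m * (1 - X ^ m) * (X - X ^ m) := by
  rcases m with _ | m
  · rw [eulerPolyInv_of_neg (by norm_num)]; simp
  · have h : ((m + 1 : ℕ) : ℤ) - 2 = m - 1 := by push_cast; ring
    rw [h, eulerPolyInv_sub_one, eulerPolyInv_succ m, pow_succ]
    ring

/-- This is two applications of the q-Pascal rule with denominators cleared. The zero convention at
negative indices lets it hold at m = 0 and m = 1 too. -/
lemma eulerPolyInv_recursion (m N : ℕ) :
    (1 - X ^ (m + N + 1)) * (1 - X ^ (m + N + 2)) * (eulerPolyInv m * eulerPolyInv (N + 2 : ℕ)) =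
      X ^ m * (eulerPolyInv m * eulerPolyInv N)
      + (1 + X ^ (m + N + 1)) * (eulerPolyInv (m - 1) * eulerPolyInv (N + 1 : ℕ))
      + X ^ (N + 2) * (eulerPolyInv (m - 2) * eulerPolyInv (N + 2 : ℕ)) := by
  rw [eulerPolyInv_succ N, eulerPolyInv_succ (N + 1), eulerPolyInv_sub_one]
  linear_combination (-X ^ (N + 1) * eulerPolyInv (N + 2 : ℕ)) * eulerPolyInv_sub_two m

/-- The Gaussian binomial coefficient `[2 * n + 1, n - k]`. -/
noncomputable def centralGauss (n k : ℕ) : ℤ⟦X⟧ :=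
  eulerPoly ℤ (2 * n + 1) * (eulerPolyInv (n - k) * eulerPolyInv (n + k + 1 : ℕ))

lemma centralGauss_of_lt {n k : ℕ} (h : n < k) : centralGauss n k = 0 := by
  rw [centralGauss, eulerPolyInv_of_neg (by omega)]; simp

/-- The boundary case of the recursion: the neighbour at k = -1 equals the one at k = 0 by symmetry
of Gaussian binomials, which adds X^(n+1) to the middle coefficient. -/
lemma centralGauss_succ_zero (n : ℕ) :
    centralGauss (n + 1) 0 = (1 + X ^ (n + 1) + X ^ (2 * n + 2)) * centralGauss n 0
      + X ^ (n + 2) * centralGauss n 1 := by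
  have h := eulerPolyInv_recursion (n + 1) n
  have e1 : n + 1 + n + 1 = 2 * n + 2 := by ring
  have e2 : n + 1 + n + 2 = 2 * n + 1 + 1 + 1 := by ring
  have e3 : ((n + 1 : ℕ) : ℤ) - 1 = n := by push_cast; ring
  have e4 : ((n + 1 : ℕ) : ℤ) - 2 = n - 1 := by push_cast; ring
  rw [e1, e2, e3, e4] at h
  rw [centralGauss, centralGauss, centralGauss, show 2 * (n + 1) + 1 = 2 * n + 1 + 1 + 1 by ring,
    eulerPoly_succ, eulerPoly_succ]
  simp only [Nat.cast_zero, sub_zero, add_zero, Nat.cast_one, add_assoc, Nat.reduceAdd] at h ⊢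
  linear_combination eulerPoly ℤ (2 * n + 1) * h

lemma centralGauss_succ_succ {n k : ℕ} (hk : k ≤ n) :
    centralGauss (n + 1) (k + 1) = X ^ (n - k) * centralGauss n k
      + (1 + X ^ (2 * n + 2)) * centralGauss n (k + 1)
      + X ^ (n + k + 3) * centralGauss n (k + 2) := by
  obtain ⟨m, rfl⟩ := Nat.exists_eq_add_of_le hk
  have h := eulerPolyInv_recursion m (k + m + k + 1)
  have e1 : m + (k + m + k + 1) + 1 = 2 * (k + m) + 2 := by ring
  have e2 : m + (k + m + k + 1) + 2 = 2 * (k + m) + 1 + 1 + 1 := by ring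
  rw [e1, e2] at h
  have e3 : ((k + m + 1 : ℕ) : ℤ) - (k + 1 : ℕ) = m := by push_cast; ring
  have e4 : ((k + m : ℕ) : ℤ) - (k : ℕ) = m := by push_cast; ring
  have e5 : ((k + m : ℕ) : ℤ) - (k + 1 : ℕ) = m - 1 := by push_cast; ring
  have e6 : ((k + m : ℕ) : ℤ) - (k + 2 : ℕ) = m - 2 := by push_cast; ring
  rw [centralGauss, centralGauss, centralGauss, centralGauss, e3, e4, e5, e6,
    show 2 * (k + m + 1) + 1 = 2 * (k + m) + 1 + 1 + 1 by ring, eulerPoly_succ, eulerPoly_succ,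
    Nat.add_sub_cancel_left, show k + m + 1 + (k + 1) + 1 = k + m + k + 1 + 2 by ring,
    show k + m + (k + 1) + 1 = k + m + k + 1 + 1 by ring,
    show k + m + (k + 2) + 1 = k + m + k + 1 + 2 by ring]
  linear_combination eulerPoly ℤ (2 * (k + m) + 1) * h

/-- The triangular numbers. -/
def triangular (k : ℕ) : ℕ := k * (k + 1) / 2

lemma two_mul_triangular (k : ℕ) : 2 * triangular k = k * (k + 1) :=
  Nat.mul_div_cancel' (Nat.even_mul_succ_self k).two_dvd

lemma triangular_succ (k : ℕ) : triangular (k + 1) = triangular k + (k + 1) := by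
  have h1 := two_mul_triangular k
  have h2 := two_mul_triangular (k + 1)
  nlinarith

lemma le_triangular (k : ℕ) : k ≤ triangular k := by
  cases k with
  | zero => simp
  | succ k => rw [triangular_succ]; omega

/-- Summation by parts: the weights 2k + 1 form an arithmetic progression, so the three-term
operator acts on them as multiplication by (1 - u)^2, up to boundary terms. -/
lemma sum_three_term_telescope {R : Type*} [CommRing R] (u : R) (e : ℕ → R) (N : ℕ) :
    (1 + u + u ^ 2) * e 0 - u * e 1 + ∑ k ∈ Finset.range N, (2 * k + 3 : R) *
        (-u * e k + (1 + u ^ 2) * e (k + 1) - u * e (k + 2)) =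
      (1 - u) ^ 2 * ∑ k ∈ Finset.range N, (2 * k + 1 : R) * e k
      + ((1 + u ^ 2) * (2 * N + 1) - u * (2 * N - 1)) * e N - (2 * N + 1) * u * e (N + 1) := by
  induction N with
  | zero => simp; ring
  | succ N ih =>
    rw [Finset.sum_range_succ, Finset.sum_range_succ, ← add_assoc, ih]
    push_cast
    ring

/-- A finite form of Jacobi's identity: as n grows, `centralGauss n k` tends to 1/f. The induction
is the telescoping above with u = X^(n+1). -/
lemma eulerPoly_sq (n : ℕ) :
    eulerPoly ℤ n ^ 2 = ∑ k ∈ Finset.range (n + 1),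
      (2 * k + 1 : ℤ⟦X⟧) * ((-1) ^ k * X ^ triangular k * centralGauss n k) := by
  induction n with
  | zero =>
    have h := eulerPoly_mul_eulerPolyInv 1
    have h0 := eulerPoly_mul_eulerPolyInv 0
    rw [eulerPoly_zero, one_mul] at h0
    have e0 : triangular 0 = 0 := rfl
    rw [zero_add, Finset.sum_range_one, eulerPoly_zero, e0, centralGauss, mul_zero, zero_add,
      sub_self, ← Nat.cast_zero (R := ℤ), h0, one_mul, h]
    simp
  | succ n ih =>
    rw [Finset.sum_range_succ', eulerPoly_succ, mul_pow, ih]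
    have key := sum_three_term_telescope ((X : ℤ⟦X⟧) ^ (n + 1))
      (fun k => (-1) ^ k * X ^ triangular k * centralGauss n k) (n + 1)
    simp only [centralGauss_of_lt (Nat.lt_succ_self n),
      centralGauss_of_lt (show n < n + 1 + 1 by omega), mul_zero, add_zero, sub_zero] at key
    rw [mul_comm, ← key]
    refine (add_comm _ _).trans (congrArg₂ (· + ·) ?_ ?_)
    · refine Finset.sum_congr rfl fun k hk => ?_
      have hkn : k ≤ n := by simpa [Nat.lt_succ_iff] using hk
      rw [centralGauss_succ_succ hkn]
      obtain ⟨m, rfl⟩ := Nat.exists_eq_add_of_le hkn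
      rw [Nat.add_sub_cancel_left, triangular_succ (k + 1), triangular_succ k]
      push_cast
      ring
    · rw [centralGauss_succ_zero, triangular_succ]
      simp [triangular]
      ring

/-- The series `∑ (-1) ^ k * (2 * k + 1) * X ^ (k * (k + 1) / 2)`. -/
noncomputable def jacobiSeries : ℤ⟦X⟧ := PowerSeries.mk fun n =>
  ∑ k ∈ Finset.range (n + 1), if triangular k = n then (-1) ^ k * (2 * k + 1 : ℤ) else 0

lemma X_pow_dvd_jacobiSeries_sub {d n : ℕ} (h : d ≤ n + 1) :
    X ^ d ∣ jacobiSeries - ∑ k ∈ Finset.range (n + 1),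
      (2 * k + 1 : ℤ⟦X⟧) * ((-1) ^ k * X ^ triangular k) := by
  rw [X_pow_dvd_iff]
  intro j hj
  have h1 : ∀ k : ℕ, (2 * k + 1 : ℤ⟦X⟧) * ((-1) ^ k * X ^ triangular k)
      = C ((-1) ^ k * (2 * k + 1 : ℤ)) * X ^ triangular k := fun k => by
    simp; ring
  rw [map_sub, map_sum, jacobiSeries, coeff_mk, sub_eq_zero]
  simp only [h1, coeff_C_mul, coeff_X_pow, mul_ite, mul_one, mul_zero]
  simp only [eq_comm (a := j)]
  refine Finset.sum_subset (Finset.range_subset_range.2 (by omega)) fun k _ hk => if_neg ?_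
  have := le_triangular k
  simp only [Finset.mem_range] at hk
  omega

lemma X_pow_dvd_euler_sub_of_le {d m : ℕ} (h : d ≤ m + 1) :
    (X : ℤ⟦X⟧) ^ d ∣ euler - eulerPoly ℤ m :=
  (pow_dvd_pow _ h).trans (X_pow_dvd_euler_sub m)

/-- Jacobi's identity. -/
theorem euler_pow_three : euler ^ 3 = jacobiSeries := by
  refine eq_of_forall_X_pow_dvd_sub fun d => ?_
  have h1 : X ^ d ∣ euler * eulerPoly ℤ (2 * d) ^ 2 - ∑ k ∈ Finset.range (2 * d + 1),
      (2 * k + 1 : ℤ⟦X⟧) * ((-1) ^ k * X ^ triangular k) := by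
    rw [eulerPoly_sq, Finset.mul_sum, ← Finset.sum_sub_distrib]
    refine Finset.dvd_sum fun k hk => ?_
    simp only [Finset.mem_range] at hk
    -- For k ≤ d all Euler polynomials involved have index at least d, so they agree with `euler`
    -- modulo X^d; for k > d the triangular exponent already kills the term.
    rcases le_or_gt k d with hkd | hkd
    · have e1 := eulerPoly_mul_eulerPolyInv (2 * d - k)
      have e2 := eulerPoly_mul_eulerPolyInv (2 * d + k + 1)
      rw [Nat.cast_sub (by omega)] at e1
      have h2 : (X : ℤ⟦X⟧) ^ d ∣ euler * eulerPoly ℤ (2 * (2 * d) + 1) -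
          eulerPoly ℤ (2 * d - k) * eulerPoly ℤ (2 * d + k + 1) := by
        have a1 := X_pow_dvd_euler_sub_of_le (show d ≤ 2 * (2 * d) + 1 + 1 by omega)
        have a2 := X_pow_dvd_euler_sub_of_le (show d ≤ 2 * d - k + 1 by omega)
        have a3 := X_pow_dvd_euler_sub_of_le (show d ≤ 2 * d + k + 1 + 1 by omega)
        refine dvd_mul_sub_mul a2 ?_
        convert! dvd_sub a3 a1 using 1
        ring
      have h3 := h2.mul_right ((2 * k + 1 : ℤ⟦X⟧) * ((-1) ^ k * X ^ triangular k) *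
        (eulerPolyInv ((2 * d : ℕ) - k) * eulerPolyInv (2 * d + k + 1 : ℕ)))
      refine h3.trans (dvd_of_eq ?_)
      rw [centralGauss]
      linear_combination (-(2 * k + 1 : ℤ⟦X⟧) * ((-1) ^ k * X ^ triangular k)) *
        (eulerPoly ℤ (2 * d + k + 1) * eulerPolyInv (2 * d + k + 1 : ℕ) * e1 + e2)
    · have h2 : (X : ℤ⟦X⟧) ^ d ∣ X ^ triangular k :=
        pow_dvd_pow _ (hkd.le.trans (le_triangular k))
      refine dvd_sub ?_ ((h2.mul_left _).mul_left _)
      exact (((h2.mul_left _).mul_right _).mul_left _).mul_left _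
  have h2 := X_pow_dvd_jacobiSeries_sub (show d ≤ 2 * d + 1 by omega)
  have h3 := X_pow_dvd_euler_sub_of_le (show d ≤ 2 * d + 1 by omega)
  have h4 : (X : ℤ⟦X⟧) ^ d ∣ euler * (euler * euler) -
      euler * (eulerPoly ℤ (2 * d) * eulerPoly ℤ (2 * d)) :=
    dvd_mul_sub_mul (by simp) (dvd_mul_sub_mul h3 h3)
  refine (dvd_sub (dvd_add h4 h1) h2).trans (dvd_of_eq ?_)
  ring

/-! ### Three-dissection of the cube of the Euler product. -/

lemma coeff_euler_pow_three (n : ℕ) : coeff n (euler ^ 3) =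
    ∑ k ∈ Finset.range (n + 1), if triangular k = n then (-1) ^ k * (2 * k + 1 : ℤ) else 0 := by
  rw [euler_pow_three, jacobiSeries, coeff_mk]

lemma triangular_strictMono : StrictMono triangular :=
  strictMono_nat_of_lt_succ fun k => by rw [triangular_succ]; omega

lemma coeff_triangular_euler_pow_three (k : ℕ) :
    coeff (triangular k) (euler ^ 3) = (-1) ^ k * (2 * k + 1 : ℤ) := by
  rw [coeff_euler_pow_three, Finset.sum_eq_single k]
  · simp
  · intro j _ hj
    exact if_neg fun h => hj (triangular_strictMono.injective h)
  · intro h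
    have := le_triangular k
    simp only [Finset.mem_range] at h
    omega

lemma exists_of_coeff_euler_pow_three_ne_zero {n : ℕ} (h : coeff n (euler ^ 3) ≠ 0) :
    ∃ k, triangular k = n := by
  by_contra! hn
  refine h ?_
  rw [coeff_euler_pow_three]
  exact Finset.sum_eq_zero fun k _ => if_neg (hn k)

lemma slice_two_euler_pow_three : slice 2 (euler ^ 3) = 0 := by
  ext n
  rw [coeff_slice, map_zero]
  by_contra h
  obtain ⟨k, hk⟩ := exists_of_coeff_euler_pow_three_ne_zero h
  have h2 := two_mul_triangular k
  rw [hk] at h2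
  have h3 : (2 * (3 * n + 2)) % 3 = (k % 3) * ((k + 1) % 3) % 3 := by
    rw [h2, Nat.mul_mod]
  have : k % 3 = 0 ∨ k % 3 = 1 ∨ k % 3 = 2 := by omega
  rcases this with h | h | h <;> simp [h, Nat.add_mod] at h3 <;> omega

lemma triangular_three_mul_add_one (k : ℕ) : triangular (3 * k + 1) = 9 * triangular k + 1 := by
  have h1 := two_mul_triangular k
  have h2 := two_mul_triangular (3 * k + 1)
  nlinarith

/-- Triangular numbers congruent to 1 mod 3 have index 3k + 1 and equal 9 T_k + 1; the Jacobi
coefficient is then multiplied by -3. -/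
lemma slice_one_euler_pow_three : slice 1 (euler ^ 3) = -3 * cube (euler ^ 3) := by
  ext n
  have h0 : (-3 * cube (euler ^ 3) : ℤ⟦X⟧) = C (-3) * cube (euler ^ 3) := by simp
  rw [coeff_slice, h0, coeff_C_mul]
  by_cases hn : ∃ k, n = 3 * triangular k
  · obtain ⟨k, rfl⟩ := hn
    rw [coeff_cube_mul, coeff_triangular_euler_pow_three,
      show 3 * (3 * triangular k) + 1 = triangular (3 * k + 1) by
        rw [triangular_three_mul_add_one]; ring, coeff_triangular_euler_pow_three]
    have h1 : (-1 : ℤ) ^ (3 * k + 1) = -(-1) ^ k := by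
      rw [pow_succ, pow_mul]; norm_num
    rw [h1]
    push_cast
    ring
  · have h1 : coeff n (cube (euler ^ 3)) = 0 := by
      by_cases h3 : 3 ∣ n
      · obtain ⟨m, rfl⟩ := h3
        rw [coeff_cube_mul]
        by_contra h
        obtain ⟨k, rfl⟩ := exists_of_coeff_euler_pow_three_ne_zero h
        exact hn ⟨k, rfl⟩
      · exact coeff_cube_of_not_dvd h3 _
    rw [h1, mul_zero]
    by_contra h
    obtain ⟨k, hk⟩ := exists_of_coeff_euler_pow_three_ne_zero h
    have h2 := two_mul_triangular k
    obtain ⟨m, hm | hm | hm⟩ : ∃ m, k = 3 * m ∨ k = 3 * m + 1 ∨ k = 3 * m + 2 :=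
      ⟨k / 3, by omega⟩
    · rw [hk, hm] at h2
      have : 2 * (3 * n + 1) = 3 * (m * (3 * m + 1)) := by rw [h2]; ring
      omega
    · rw [hm, triangular_three_mul_add_one] at hk
      exact hn ⟨m, by omega⟩
    · rw [hk, hm] at h2
      have : 2 * (3 * n + 1) = 3 * ((3 * m + 2) * (m + 1)) := by rw [h2]; ring
      omega

/-! ### The product of the Euler product over the cube roots of unity -/

section CubeRoot

variable {R : Type*} [CommRing R] {ω : R}

lemma rescale_eulerPoly_succ (a : R) (n : ℕ) :
    rescale a (eulerPoly R (n + 1)) =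
      rescale a (eulerPoly R n) * (1 - C (a ^ (n + 1)) * X ^ (n + 1)) := by
  rw [eulerPoly_succ, map_mul, map_sub, map_one, map_pow, rescale_X, mul_pow, map_pow]

lemma expand_eulerPoly_succ {p : ℕ} (hp : p ≠ 0) (n : ℕ) :
    expand p hp (eulerPoly R (n + 1)) =
      expand p hp (eulerPoly R n) * (1 - X ^ (p * (n + 1))) := by
  rw [eulerPoly_succ, map_mul, map_sub, map_one, map_pow, expand_X, pow_mul]

lemma mul_mul_one_sub_cubeRoot (h : 1 + ω + ω ^ 2 = 0) (Y : R⟦X⟧) :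
    (1 - Y) * (1 - C ω * Y) * (1 - C (ω ^ 2) * Y) = 1 - Y ^ 3 := by
  have h1 : (1 + C ω + C ω ^ 2 : R⟦X⟧) = 0 := by
    rw [← map_pow, ← map_one C, ← map_add, ← map_add, h, map_zero]
  rw [map_pow]
  linear_combination (-Y + Y ^ 2 * C ω - Y ^ 3 * (C ω - 1)) * h1

/-- Over the three rescalings, a factor 1 - X^i with 3 ∤ i contributes its norm 1 - X^(3i), and one
with 3 ∣ i is fixed and contributes its cube. Taking 3m factors keeps the blocks of three complete.
-/
lemma eulerPoly_mul_rescale (h : 1 + ω + ω ^ 2 = 0) (m : ℕ) :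
    eulerPoly R (3 * m) * rescale ω (eulerPoly R (3 * m)) * rescale (ω ^ 2) (eulerPoly R (3 * m))
        * expand 9 (by norm_num) (eulerPoly R m) =
      expand 3 three_ne_zero (eulerPoly R (3 * m)) *
        expand 3 three_ne_zero (eulerPoly R m) ^ 3 := by
  have h3 : ω ^ 3 = 1 := by linear_combination (ω - 1) * h
  induction m with
  | zero => simp
  | succ m ih =>
    have e : 3 * (m + 1) = 3 * m + 1 + 1 + 1 := by ring
    have w1 : ω ^ (3 * m + 1) = ω := by rw [pow_succ, pow_mul, h3, one_pow, one_mul]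
    have w2 : ω ^ (3 * m + 1 + 1) = ω ^ 2 := by rw [pow_succ, w1, sq]
    have w3 : ω ^ (3 * m + 1 + 1 + 1) = 1 := by rw [pow_succ, w2, ← pow_succ, h3]
    have w1' : (ω ^ 2) ^ (3 * m + 1) = ω ^ 2 := by rw [pow_right_comm, w1]
    have w2' : (ω ^ 2) ^ (3 * m + 1 + 1) = ω := by
      rw [pow_right_comm, w2, ← pow_mul, show 2 * 2 = 3 + 1 by rfl, pow_succ, h3, one_mul]
    have w3' : (ω ^ 2) ^ (3 * m + 1 + 1 + 1) = 1 := by rw [pow_right_comm, w3, one_pow]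
    rw [e]
    rw [rescale_eulerPoly_succ, rescale_eulerPoly_succ, rescale_eulerPoly_succ,
      rescale_eulerPoly_succ, rescale_eulerPoly_succ, rescale_eulerPoly_succ,
      expand_eulerPoly_succ, expand_eulerPoly_succ, expand_eulerPoly_succ, expand_eulerPoly_succ,
      expand_eulerPoly_succ, eulerPoly_succ, eulerPoly_succ, eulerPoly_succ,
      w1, w2, w3, w1', w2', w3', map_one]
    have f1 := mul_mul_one_sub_cubeRoot h ((X : R⟦X⟧) ^ (3 * m + 1))
    have f2 := mul_mul_one_sub_cubeRoot h ((X : R⟦X⟧) ^ (3 * m + 1 + 1))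
    have p1 : ((X : R⟦X⟧) ^ (3 * m + 1)) ^ 3 = X ^ (3 * (3 * m + 1)) := by
      rw [← pow_mul, mul_comm]
    have p2 : ((X : R⟦X⟧) ^ (3 * m + 1 + 1)) ^ 3 = X ^ (3 * (3 * m + 1 + 1)) := by
      rw [← pow_mul, mul_comm]
    have p3 : (X : R⟦X⟧) ^ (9 * (m + 1)) = X ^ (3 * (3 * m + 1 + 1 + 1)) := by
      congr 1; ring
    have p4 : (X : R⟦X⟧) ^ (3 * (m + 1)) = X ^ (3 * m + 1 + 1 + 1) := by rw [e]
    rw [p1] at f1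
    rw [p2] at f2
    rw [p3, p4, ← f1, ← f2, one_mul]
    linear_combination ((1 - X ^ (3 * m + 1)) * (1 - C ω * X ^ (3 * m + 1))
      * (1 - C (ω ^ 2) * X ^ (3 * m + 1))) * ((1 - X ^ (3 * m + 1 + 1))
      * (1 - C ω * X ^ (3 * m + 1 + 1)) * (1 - C (ω ^ 2) * X ^ (3 * m + 1 + 1))) *
      (1 - X ^ (3 * m + 1 + 1 + 1)) ^ 3 * (1 - X ^ (3 * (3 * m + 1 + 1 + 1))) * ih

lemma X_pow_dvd_rescale {n : ℕ} {F : R⟦X⟧} (a : R) (h : X ^ n ∣ F) : X ^ n ∣ rescale a F := by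
  obtain ⟨G, rfl⟩ := h
  rw [map_mul, map_pow, rescale_X, mul_pow]
  exact (Dvd.intro_left _ rfl).mul_right _

lemma X_pow_dvd_expand {n p : ℕ} (hp : p ≠ 0) {F : R⟦X⟧} (h : X ^ n ∣ F) :
    X ^ n ∣ expand p hp F := by
  obtain ⟨G, rfl⟩ := h
  rw [map_mul, map_pow, expand_X, ← pow_mul]
  exact (pow_dvd_pow _ (Nat.le_mul_of_pos_left _ (Nat.pos_of_ne_zero hp))).mul_right _

lemma map_eulerPoly (n : ℕ) : map (Int.castRingHom R) (eulerPoly ℤ n) = eulerPoly R n := by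
  simp [eulerPoly, map_prod]

lemma map_euler_mul_rescale (h : 1 + ω + ω ^ 2 = 0) :
    map (Int.castRingHom R) euler * rescale ω (map (Int.castRingHom R) euler)
        * rescale (ω ^ 2) (map (Int.castRingHom R) euler)
        * expand 9 (by norm_num) (map (Int.castRingHom R) euler) =
      expand 3 three_ne_zero (map (Int.castRingHom R) euler) ^ 4 := by
  refine eq_of_forall_X_pow_dvd_sub fun d => ?_
  set F := map (Int.castRingHom R) euler
  have key : ∀ m, d ≤ m + 1 → X ^ d ∣ F - eulerPoly R m := fun m hm => by
    have := map_dvd (map (Int.castRingHom R)) (X_pow_dvd_euler_sub_of_le hm)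
    rwa [map_pow, map_X, map_sub, map_eulerPoly] at this
  have k3 := key (3 * d) (by omega)
  have k1 := key d (by omega)
  have r1 := X_pow_dvd_rescale ω k3
  have r2 := X_pow_dvd_rescale (ω ^ 2) k3
  have e9 := X_pow_dvd_expand (show 9 ≠ 0 by norm_num) k1
  have e3 := X_pow_dvd_expand three_ne_zero k1
  have e3' := X_pow_dvd_expand three_ne_zero k3
  rw [map_sub] at r1 r2 e9 e3 e3'
  have l := dvd_mul_sub_mul (dvd_mul_sub_mul (dvd_mul_sub_mul k3 r1) r2) e9
  have r := dvd_mul_sub_mul e3' (e3.trans (sub_dvd_pow_sub_pow _ _ 3))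
  rw [eulerPoly_mul_rescale h] at l
  convert! dvd_sub l r using 1
  ring

lemma rescale_expand_three (h : ω ^ 3 = 1) (F : R⟦X⟧) :
    rescale ω (expand 3 three_ne_zero F) = expand 3 three_ne_zero F := by
  ext n
  rw [coeff_rescale]
  by_cases hn : 3 ∣ n
  · obtain ⟨m, rfl⟩ := hn
    rw [pow_mul, h, one_pow, one_mul]
  · rw [coeff_expand_of_not_dvd 3 _ _ hn, mul_zero]

end CubeRoot

/-! ### Norm of the dissected cube. -/

/-- The part of `euler ^ 3` with exponents divisible by three, as a series in `X ^ 3`. -/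
noncomputable def eulerCubeSlice : ℤ⟦X⟧ := slice 0 (euler ^ 3)

lemma euler_pow_three_eq :
    euler ^ 3 = cube eulerCubeSlice - 3 * (X * cube (cube euler) ^ 3) := by
  conv_lhs => rw [eq_sum_cube_slice (euler ^ 3)]
  rw [slice_one_euler_pow_three, slice_two_euler_pow_three, eulerCubeSlice]
  simp only [map_mul, map_neg, map_ofNat, map_zero, map_pow]
  ring

lemma exists_cubeRoot : ∃ ω : ℂ, 1 + ω + ω ^ 2 = 0 := by
  have h := (Complex.isPrimitiveRoot_exp 3 three_ne_zero).geom_sum_eq_zero (by norm_num)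
  rw [Finset.sum_range_succ, Finset.sum_range_succ, Finset.sum_range_one, pow_zero, pow_one] at h
  exact ⟨_, h⟩

/-- With f^3 = A - B, where A and B/X are series in X^3, the product of the three conjugates is A^3
- B^3. The root of unity lives in ℂ, and injectivity of the coefficient map brings the identity back
to ℤ. -/
lemma cube_norm_euler_pow_three :
    (cube eulerCubeSlice ^ 3 - 27 * (X * cube (cube euler) ^ 3) ^ 3) * cube (cube euler) ^ 3
      = cube euler ^ 12 := by
  obtain ⟨ω, h⟩ := exists_cubeRoot
  have h3 : ω ^ 3 = 1 := by linear_combination (ω - 1) * h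
  have h3' : (ω ^ 2) ^ 3 = 1 := by rw [pow_right_comm, h3, one_pow]
  have hC : (1 + C ω + C ω ^ 2 : ℂ⟦X⟧) = 0 := by
    rw [← map_pow, ← map_one C, ← map_add, ← map_add, h, map_zero]
  have inj : Function.Injective (map (Int.castRingHom ℂ)) :=
    map_injective _ (RingHom.injective_int _)
  apply inj
  have prod := congrArg (· ^ 3) (map_euler_mul_rescale h)
  have e0 := congrArg (map (Int.castRingHom ℂ)) euler_pow_three_eq
  simp only [map_sub, map_mul, map_pow, map_ofNat, cube, map_expand, map_X] at e0 ⊢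
  rw [expand_mul 3 three_ne_zero 3 three_ne_zero] at prod
  set F := map (Int.castRingHom ℂ) euler
  set A := expand 3 three_ne_zero (map (Int.castRingHom ℂ) eulerCubeSlice)
  set D := expand 3 three_ne_zero (expand 3 three_ne_zero F)
  have e1 := congrArg (rescale ω) e0
  have e2 := congrArg (rescale (ω ^ 2)) e0
  have a1 : rescale ω A = A := rescale_expand_three h3 _
  have a2 : rescale (ω ^ 2) A = A := rescale_expand_three h3' _
  have d1 : rescale ω D = D := rescale_expand_three h3 _
  have d2 : rescale (ω ^ 2) D = D := rescale_expand_three h3' _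
  simp only [map_sub, map_mul, map_pow, map_ofNat, rescale_X, a1, a2, d1, d2] at e1 e2
  simp only [mul_pow, e0, e1, e2] at prod
  linear_combination prod + D ^ 3 * (3 * (X * D ^ 3) * A ^ 2 - 9 * (X * D ^ 3) ^ 2 * A * C ω
    - 27 * (X * D ^ 3) ^ 3 * (1 - C ω)) * hC

/-! ### The cubic modular equation -/

lemma euler_pow_mul_eulerInv_pow (n : ℕ) : euler ^ n * eulerInv ^ n = 1 := by
  rw [← mul_pow, euler_mul_eulerInv, one_pow]

lemma cube_euler_pow_mul_eulerInv_pow (n : ℕ) : cube euler ^ n * cube eulerInv ^ n = 1 := by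
  rw [← map_pow, ← map_pow, ← map_mul, euler_pow_mul_eulerInv_pow, map_one]

lemma cube_cube_euler_pow_mul_eulerInv_pow (n : ℕ) :
    cube (cube euler) ^ n * cube (cube eulerInv) ^ n = 1 := by
  rw [← map_pow cube (cube euler), ← map_pow cube (cube eulerInv), ← map_mul,
    cube_euler_pow_mul_eulerInv_pow, map_one]

/-- The eta quotient `q * f(q ^ 9) ^ 3 / f(q) ^ 3`. -/
noncomputable def etaNine : ℤ⟦X⟧ := X * cube (cube euler) ^ 3 * eulerInv ^ 3

/-- The eta quotient `q * f(q ^ 3) ^ 12 / f(q) ^ 12`. -/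
noncomputable def etaThree : ℤ⟦X⟧ := X * cube euler ^ 12 * eulerInv ^ 12

lemma cube_etaThree :
    cube etaThree = X ^ 3 * cube (cube euler) ^ 12 * cube eulerInv ^ 12 := by
  simp [etaThree, cube_X]

lemma etaNine_mul_euler_pow_three : etaNine * euler ^ 3 = X * cube (cube euler) ^ 3 := by
  rw [etaNine]
  linear_combination X * cube (cube euler) ^ 3 * euler_pow_mul_eulerInv_pow 3

lemma etaNine_mul_inv : X * eulerInv ^ 3 = cube (cube eulerInv ^ 3) * etaNine := by
  rw [etaNine, map_pow]
  linear_combination (-X * eulerInv ^ 3) * cube_cube_euler_pow_mul_eulerInv_pow 3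

lemma eulerInv_ne_zero : eulerInv ≠ 0 :=
  right_ne_zero_of_mul (by rw [euler_mul_eulerInv]; exact one_ne_zero)

lemma cube_ne_zero {F : ℤ⟦X⟧} (h : F ≠ 0) : cube F ≠ 0 :=
  (map_ne_zero_iff cube cube_injective).2 h

lemma etaNine_ne_zero : etaNine ≠ 0 :=
  mul_ne_zero (mul_ne_zero X_ne_zero (pow_ne_zero _ (cube_ne_zero (cube_ne_zero euler_ne_zero))))
    (pow_ne_zero _ eulerInv_ne_zero)

lemma etaThree_ne_zero : etaThree ≠ 0 :=
  mul_ne_zero (mul_ne_zero X_ne_zero (pow_ne_zero _ (cube_ne_zero euler_ne_zero)))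
    (pow_ne_zero _ eulerInv_ne_zero)

lemma cube_etaThree_mul_etaThree : cube etaThree * etaThree = etaNine ^ 4 := by
  rw [cube_etaThree, etaThree, etaNine]
  linear_combination X ^ 4 * cube (cube euler) ^ 12 * eulerInv ^ 12
    * cube_euler_pow_mul_eulerInv_pow 12

lemma one_add_etaNine : 1 + 9 * etaNine + 27 * etaNine ^ 2 = eulerInv ^ 6 *
    (cube eulerCubeSlice ^ 2 + 3 * cube eulerCubeSlice * (X * cube (cube euler) ^ 3)
      + 9 * (X * cube (cube euler) ^ 3) ^ 2) := by
  have hA : cube eulerCubeSlice = euler ^ 3 + 3 * (X * cube (cube euler) ^ 3) := by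
    rw [euler_pow_three_eq]; ring
  rw [hA, etaNine]
  linear_combination (-(euler ^ 3 * eulerInv ^ 3 + 1) - 9 * X * cube (cube euler) ^ 3
    * eulerInv ^ 3) * euler_pow_mul_eulerInv_pow 3

/-- Rationalising the denominator: 1/(A - B) = (A^2 + AB + B^2)/(A^3 - B^3), with the norm already
evaluated. -/
lemma eulerInv_pow_three_eq : eulerInv ^ 3 = cube (cube euler ^ 3 * eulerInv ^ 12) *
    (cube eulerCubeSlice ^ 2 + 3 * cube eulerCubeSlice * (X * cube (cube euler) ^ 3)
      + 9 * (X * cube (cube euler) ^ 3) ^ 2) := by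
  have h1 := euler_pow_mul_eulerInv_pow 3
  have h2 := cube_norm_euler_pow_three
  have h3 := euler_pow_three_eq
  have h4 := cube_euler_pow_mul_eulerInv_pow 12
  rw [map_mul, map_pow, map_pow]
  set A := cube eulerCubeSlice
  set D := cube (cube euler)
  linear_combination (-eulerInv ^ 3) * h4 - eulerInv ^ 3 * cube eulerInv ^ 12 * h2
    + D ^ 3 * cube eulerInv ^ 12 * (A ^ 2 + 3 * A * (X * D ^ 3) + 9 * (X * D ^ 3) ^ 2)
      * (h1 - eulerInv ^ 3 * h3)

/-- The modular equation of degree three. -/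
lemma etaNine_pow_three :
    etaNine ^ 3 = cube etaThree * (1 + 9 * etaNine + 27 * etaNine ^ 2) := by
  have h := eulerInv_pow_three_eq
  rw [one_add_etaNine, cube_etaThree, etaNine]
  simp only [map_mul, map_pow] at h
  linear_combination X ^ 3 * cube (cube euler) ^ 9 * eulerInv ^ 6 * h

lemma eulerCubeSlice_pow_three :
    eulerCubeSlice ^ 3 * (cube euler ^ 3 * eulerInv ^ 12) = 1 + 27 * etaThree := by
  apply cube_injective
  have h2 := cube_norm_euler_pow_three
  have h4 := cube_euler_pow_mul_eulerInv_pow 12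
  simp only [map_add, map_mul, map_pow, map_one, map_ofNat, cube_etaThree]
  linear_combination cube eulerInv ^ 12 * h2 + h4

lemma etaNine_eq : etaNine = cube (9 * etaThree)
    + X * cube (cube euler ^ 6 * eulerInv ^ 12 * eulerCubeSlice ^ 2)
    + X ^ 2 * cube (3 * (cube euler ^ 9 * eulerInv ^ 12 * eulerCubeSlice)) := by
  have h := eulerInv_pow_three_eq
  simp only [map_mul, map_pow, map_ofNat, cube_etaThree] at h ⊢
  rw [etaNine]
  linear_combination X * cube (cube euler) ^ 3 * h

lemma slice_zero_etaNine : slice 0 etaNine = 9 * etaThree := by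
  rw [etaNine_eq, slice_sum_cube (by norm_num), if_pos rfl]

lemma slice_two_etaNine :
    slice 2 etaNine = 3 * (cube euler ^ 9 * eulerInv ^ 12 * eulerCubeSlice) := by
  conv_lhs => rw [etaNine_eq]
  rw [slice_sum_cube (by norm_num), if_neg (by norm_num), if_neg (by norm_num)]

lemma slice_zero_etaNine_sq : slice 0 (etaNine ^ 2) = 6 * etaThree + 243 * etaThree ^ 2 := by
  have h : etaNine ^ 2 = cube (6 * etaThree * (eulerCubeSlice ^ 3 *
        (cube euler ^ 3 * eulerInv ^ 12)) + 81 * etaThree ^ 2)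
      + X * cube (27 * X * eulerInv ^ 24 * cube euler ^ 18 * eulerCubeSlice ^ 2)
      + X ^ 2 * cube (eulerInv ^ 24 * (cube euler ^ 12 * eulerCubeSlice ^ 4
        + 54 * X * cube euler ^ 21 * eulerCubeSlice)) := by
    conv_lhs => rw [etaNine_eq]
    simp only [map_add, map_mul, map_pow, map_ofNat, cube_etaThree, cube_X]
    ring
  rw [h, slice_sum_cube (by norm_num), if_pos rfl, eulerCubeSlice_pow_three]
  ring

lemma slice_zero_one : slice 0 (1 : ℤ⟦X⟧) = 1 := by
  have h := slice_sum_cube (show 0 < 3 by norm_num) 1 0 0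
  simpa using h

lemma slice_pow_mul {r : ℕ} (hr : r < 3) (e : ℕ) (F : ℤ⟦X⟧) :
    slice r (3 ^ e * F) = 3 ^ e * slice r F := by
  have h : (3 ^ e : ℤ⟦X⟧) = cube (3 ^ e) := by rw [map_pow, map_ofNat]
  conv_lhs => rw [h]
  rw [slice_cube_mul hr]

lemma slice_zero_etaNine_pow_add_three (k : ℕ) : slice 0 (etaNine ^ (k + 3)) =
    etaThree ^ 1 * 3 ^ 0 * slice 0 (etaNine ^ k) + etaThree ^ 1 * 3 ^ 2 * slice 0 (etaNine ^ (k + 1))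
      + etaThree ^ 1 * 3 ^ 3 * slice 0 (etaNine ^ (k + 2)) := by
  have h : etaNine ^ (k + 3) = cube etaThree * (etaNine ^ k + 3 ^ 2 * etaNine ^ (k + 1)
      + 3 ^ 3 * etaNine ^ (k + 2)) := by
    rw [pow_add, etaNine_pow_three]
    ring
  rw [h, slice_cube_mul (by norm_num), map_add, map_add, slice_pow_mul (by norm_num),
    slice_pow_mul (by norm_num)]
  ring

/-! ### Polynomials in `etaThree` with prescribed `3`-adic divisibility -/

/-- The span of the `3 ^ φ j * etaThree ^ j` with `j ∈ J`. -/
noncomputable def weightedSpan (J : Set ℕ) (φ : ℕ → ℕ) : Submodule ℤ ℤ⟦X⟧ :=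
  Submodule.span ℤ ((fun j => 3 ^ φ j * etaThree ^ j) '' J)

lemma weightedSpan_le {J : Set ℕ} {φ : ℕ → ℕ} {W : Submodule ℤ ℤ⟦X⟧}
    (h : ∀ j ∈ J, 3 ^ φ j * etaThree ^ j ∈ W) : weightedSpan J φ ≤ W := by
  rw [weightedSpan, Submodule.span_le]
  rintro _ ⟨j, hj, rfl⟩
  exact h j hj

lemma pow_mul_etaThree_pow_mem {J : Set ℕ} {φ : ℕ → ℕ} {e j : ℕ} (hj : j ∈ J) (h : φ j ≤ e) :
    3 ^ e * etaThree ^ j ∈ weightedSpan J φ := by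
  obtain ⟨d, rfl⟩ := Nat.exists_eq_add_of_le h
  have h1 : (3 ^ φ j * etaThree ^ j : ℤ⟦X⟧) ∈ weightedSpan J φ :=
    Submodule.subset_span ⟨j, hj, rfl⟩
  have := Submodule.smul_mem _ (3 ^ d : ℤ) h1
  rw [zsmul_eq_mul] at this
  convert! this using 1
  push_cast
  ring

lemma mul_mem_weightedSpan {J J' : Set ℕ} {φ φ' : ℕ → ℕ} {F : ℤ⟦X⟧} (i e : ℕ)
    (h : ∀ j ∈ J, j + i ∈ J' ∧ φ' (j + i) ≤ φ j + e) (hF : F ∈ weightedSpan J φ) :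
    etaThree ^ i * 3 ^ e * F ∈ weightedSpan J' φ' := by
  have : weightedSpan J φ ≤
      (weightedSpan J' φ').comap (LinearMap.mulLeft ℤ (etaThree ^ i * 3 ^ e)) := by
    refine weightedSpan_le fun j hj => ?_
    rw [Submodule.mem_comap, LinearMap.mulLeft_apply]
    have := pow_mul_etaThree_pow_mem (h j hj).1 (h j hj).2
    convert! this using 1
    ring
  exact this hF

/-- The exponent (9j - 3k - 1)/2 is compatible with the cubic recursion, whose coefficients are t,
9t and 27t; truncated subtraction makes it 0 at j = k = 0. -/
lemma slice_zero_etaNine_pow_mem (k : ℕ) : slice 0 (etaNine ^ k) ∈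
    weightedSpan {j | k ≤ 3 * j} (fun j => (9 * j - 3 * k - 1) / 2) := by
  induction k using Nat.strong_induction_on with
  | _ k ih =>
    match k with
    | 0 =>
      rw [pow_zero, slice_zero_one]
      have := pow_mul_etaThree_pow_mem (J := {j | 0 ≤ 3 * j})
        (φ := fun j => (9 * j - 3 * 0 - 1) / 2) (e := 0) (j := 0) (by simp) (by simp)
      simpa using this
    | 1 =>
      rw [pow_one, slice_zero_etaNine]
      have := pow_mul_etaThree_pow_mem (J := {j | 1 ≤ 3 * j})
        (φ := fun j => (9 * j - 3 * 1 - 1) / 2) (e := 2) (j := 1) (by simp) (by simp)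
      norm_num at this ⊢
      exact this
    | 2 =>
      rw [slice_zero_etaNine_sq]
      have h1 := pow_mul_etaThree_pow_mem (J := {j | 2 ≤ 3 * j})
        (φ := fun j => (9 * j - 3 * 2 - 1) / 2) (e := 1) (j := 1) (by simp) (by simp)
      have h2 := pow_mul_etaThree_pow_mem (J := {j | 2 ≤ 3 * j})
        (φ := fun j => (9 * j - 3 * 2 - 1) / 2) (e := 5) (j := 2) (by simp) (by simp)
      have := Submodule.add_mem _ (Submodule.smul_mem _ (2 : ℤ) h1) h2
      rw [zsmul_eq_mul] at this
      convert! this using 1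
      push_cast
      ring
    | k + 3 =>
      rw [slice_zero_etaNine_pow_add_three]
      refine Submodule.add_mem _ (Submodule.add_mem _
        (mul_mem_weightedSpan 1 0 ?_ (ih k (by omega)))
        (mul_mem_weightedSpan 1 2 ?_ (ih (k + 1) (by omega))))
        (mul_mem_weightedSpan 1 3 ?_ (ih (k + 2) (by omega))) <;>
      · intro j hj
        simp only [Set.mem_ofPred_eq] at hj ⊢
        omega

/-- Reduces other series to powers of ξ: multiplying by t(q^3)^i before slicing amounts to
multiplying by t^i afterwards, and t^i can be cancelled in a domain. -/
lemma mem_weightedSpan_of_etaThree_pow_mul {J : Set ℕ} {φ : ℕ → ℕ} {i k : ℕ} {F : ℤ⟦X⟧}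
    (hik : 3 * i ≤ k)
    (hJ : ∀ j, k ≤ 3 * (j + i) → j ∈ J ∧ φ j ≤ (9 * (j + i) - 3 * k - 1) / 2)
    (h : etaThree ^ i * F = slice 0 (etaNine ^ k)) : F ∈ weightedSpan J φ := by
  have hle : weightedSpan {j | k ≤ 3 * j} (fun j => (9 * j - 3 * k - 1) / 2) ≤
      (weightedSpan J φ).map
        (LinearMap.mulLeft ℤ (etaThree ^ i)) := by
    refine weightedSpan_le fun j hj => ?_
    simp only [Set.mem_ofPred_eq] at hj
    obtain ⟨m, rfl⟩ := Nat.exists_eq_add_of_le' (show i ≤ j by omega)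
    refine ⟨_, pow_mul_etaThree_pow_mem (j := m) (hJ m hj).1 (hJ m hj).2, ?_⟩
    rw [LinearMap.mulLeft_apply]
    ring
  obtain ⟨y, hy, hyF⟩ := hle (slice_zero_etaNine_pow_mem k)
  rw [LinearMap.mulLeft_apply, ← h] at hyF
  rwa [← mul_left_cancel₀ (pow_ne_zero _ etaThree_ne_zero) hyF]

lemma slice_zero_etaThree_pow_mem (i : ℕ) : slice 0 (etaThree ^ i) ∈
    weightedSpan {j | i ≤ 3 * j} (fun j => (9 * j - 3 * i - 1) / 2) := by
  refine mem_weightedSpan_of_etaThree_pow_mul (i := i) (k := 4 * i) (by omega)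
    (fun j hj => ⟨show _ ≤ 3 * j by omega, by omega⟩) (by
      rw [← slice_cube_mul (by norm_num), map_pow, ← mul_pow, cube_etaThree_mul_etaThree, pow_mul])

lemma slice_zero_etaNine_mul_etaThree_pow_mem (i : ℕ) : slice 0 (etaNine * etaThree ^ i) ∈
    weightedSpan {j | i + 1 ≤ 3 * j} (fun j => (9 * j - 3 * i - 4) / 2) := by
  refine mem_weightedSpan_of_etaThree_pow_mul (i := i) (k := 4 * i + 1) (by omega)
    (fun j hj => ⟨show _ ≤ 3 * j by omega, by omega⟩) (by
      rw [← slice_cube_mul (by norm_num), map_pow, mul_left_comm, ← mul_pow,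
        cube_etaThree_mul_etaThree, ← pow_mul, pow_succ'])

/-- The quotient `etaThree / etaNine`. -/
noncomputable def etaRatio : ℤ⟦X⟧ := cube euler ^ 12 * eulerInv ^ 9 * cube (cube eulerInv) ^ 3

lemma etaNine_mul_etaRatio : etaNine * etaRatio = etaThree := by
  rw [etaNine, etaRatio, etaThree]
  linear_combination X * cube euler ^ 12 * eulerInv ^ 12 * cube_cube_euler_pow_mul_eulerInv_pow 3

lemma cube_etaThree_mul_etaRatio : cube etaThree * etaRatio = etaNine ^ 3 := by
  refine mul_left_cancel₀ etaNine_ne_zero ?_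
  rw [mul_left_comm, etaNine_mul_etaRatio, cube_etaThree_mul_etaThree, pow_succ']

lemma slice_zero_etaRatio_mul_etaThree_pow_mem (i : ℕ) : slice 0 (etaRatio * etaThree ^ i) ∈
    weightedSpan {j | i ≤ 3 * j} (fun j => (9 * j - 3 * i - 1) / 2) := by
  refine mem_weightedSpan_of_etaThree_pow_mul (i := i + 1) (k := 4 * i + 3) (by omega)
    (fun j hj => ⟨show _ ≤ 3 * j by omega, by omega⟩) (by
      rw [← slice_cube_mul (by norm_num), map_pow, pow_add, pow_add, pow_mul,
        ← cube_etaThree_mul_etaThree,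
        ← cube_etaThree_mul_etaRatio]
      congr 1
      ring)

/-! ### Iterating the operators -/

lemma slice_zero_mul_mem {J J' : Set ℕ} {φ φ' : ℕ → ℕ} {J₁ : ℕ → Set ℕ} {φ₁ : ℕ → ℕ → ℕ}
    {M F : ℤ⟦X⟧} (hM : ∀ i, slice 0 (M * etaThree ^ i) ∈ weightedSpan (J₁ i) (φ₁ i))
    (h : ∀ i ∈ J, ∀ j ∈ J₁ i, j ∈ J' ∧ φ' j ≤ φ₁ i j + φ i) (hF : F ∈ weightedSpan J φ) :
    slice 0 (M * F) ∈ weightedSpan J' φ' := by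
  have : weightedSpan J φ ≤
      (weightedSpan J' φ').comap (slice 0 ∘ₗ LinearMap.mulLeft ℤ M) := by
    refine weightedSpan_le fun i hi => ?_
    rw [Submodule.mem_comap, LinearMap.comp_apply, LinearMap.mulLeft_apply, mul_left_comm,
      slice_pow_mul (by norm_num)]
    have := mul_mem_weightedSpan 0 (φ i) (h i hi) (hM i)
    rwa [pow_zero, one_mul] at this
  exact this hF

lemma exists_eq_etaThree_mul {φ : ℕ → ℕ} {F : ℤ⟦X⟧} (hF : F ∈ weightedSpan {j | 1 ≤ j} φ) :
    ∃ G ∈ weightedSpan Set.univ (fun j => φ (j + 1)), F = etaThree * G := by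
  have : weightedSpan {j | 1 ≤ j} φ ≤
      (weightedSpan Set.univ (fun j => φ (j + 1))).map (LinearMap.mulLeft ℤ etaThree) := by
    refine weightedSpan_le fun j hj => ?_
    obtain ⟨m, rfl⟩ := Nat.exists_eq_add_of_le' (show 1 ≤ j from hj)
    refine ⟨_, pow_mul_etaThree_pow_mem (j := m) (Set.mem_univ _) le_rfl, ?_⟩
    rw [LinearMap.mulLeft_apply]
    ring
  obtain ⟨G, hG, h⟩ := this hF
  exact ⟨G, hG, h.symm⟩

/-- The divisibility pattern after an odd number of slices. -/
noncomputable def oddSpan (c : ℕ) : Submodule ℤ ℤ⟦X⟧ :=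
  weightedSpan {j | 1 ≤ j} (fun j => c + (9 * j - 9) / 2)

/-- The divisibility pattern after an even number of slices of an inverse cube. -/
noncomputable def evenSpan (c : ℕ) : Submodule ℤ ℤ⟦X⟧ :=
  weightedSpan {j | 1 ≤ j} (fun j => c + (9 * j - 4) / 2)

/-- The divisibility pattern after an even number of slices of a quotient of cubes. -/
noncomputable def unitSpan (c : ℕ) : Submodule ℤ ℤ⟦X⟧ :=
  weightedSpan Set.univ (fun j => c + (9 * j - 1) / 2)

lemma slice_zero_mem_evenSpan {c : ℕ} {F : ℤ⟦X⟧} (hF : F ∈ oddSpan c) :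
    slice 0 F ∈ evenSpan c := by
  have := slice_zero_mul_mem (M := 1) (J' := {j | 1 ≤ j}) (φ' := fun j => c + (9 * j - 4) / 2)
    (fun i => by rw [one_mul]; exact slice_zero_etaThree_pow_mem i) (fun i hi j hj => ?_) hF
  · rwa [one_mul] at this
  · simp only [Set.mem_ofPred_eq] at hi hj ⊢
    -- At i = 1 the bound is attained; for i ≥ 2 there is slack to absorb the two floors.
    obtain rfl | h := hi.eq_or_lt <;> omega

lemma slice_zero_etaNine_mul_mem_oddSpan {c : ℕ} {F : ℤ⟦X⟧} (hF : F ∈ evenSpan c) :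
    slice 0 (etaNine * F) ∈ oddSpan (c + 3) := by
  refine slice_zero_mul_mem slice_zero_etaNine_mul_etaThree_pow_mem (fun i hi j hj => ?_) hF
  simp only [Set.mem_ofPred_eq] at hi hj ⊢
  omega

lemma slice_zero_etaNine_mul_mem_oddSpan_of_unitSpan {c : ℕ} {F : ℤ⟦X⟧} (hF : F ∈ unitSpan c) :
    slice 0 (etaNine * F) ∈ oddSpan (c + 2) := by
  refine slice_zero_mul_mem slice_zero_etaNine_mul_etaThree_pow_mem (fun i hi j hj => ?_) hF
  simp only [Set.mem_ofPred_eq] at hj ⊢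
  omega

/-- Split t as ξ · (t/ξ): since f^3 ξ = q f(q^9)^3, the factor q turns `slice 1` into `slice 0` of
(t/ξ) G. -/
lemma slice_one_mem_unitSpan {c : ℕ} {F : ℤ⟦X⟧} (hF : F ∈ oddSpan c) :
    ∃ G ∈ unitSpan c, slice 1 (euler ^ 3 * cube eulerInv ^ 3 * F) =
      cube euler ^ 3 * eulerInv ^ 3 * G := by
  obtain ⟨G, hG, rfl⟩ := exists_eq_etaThree_mul hF
  refine ⟨slice 0 (etaRatio * G), ?_, ?_⟩
  · refine slice_zero_mul_mem slice_zero_etaRatio_mul_etaThree_pow_mem (fun i hi j hj => ?_) hG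
    simp only [Set.mem_ofPred_eq] at hj
    refine ⟨Set.mem_univ _, ?_⟩
    obtain rfl | h := i.eq_zero_or_pos <;> omega
  · have h : euler ^ 3 * cube eulerInv ^ 3 * (etaThree * G) =
        cube (cube euler ^ 3 * eulerInv ^ 3) * (X * (etaRatio * G)) := by
      rw [← etaNine_mul_etaRatio, map_mul, map_pow, map_pow]
      linear_combination cube eulerInv ^ 3 * etaRatio * G * etaNine_mul_euler_pow_three
    rw [h, slice_cube_mul (by norm_num), slice_succ_X_mul]

/-- The series `∑ a (3 * n - 1) X ^ n` attached to `∑ a n X ^ n`. -/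
noncomputable def shiftSlice (F : ℤ⟦X⟧) : ℤ⟦X⟧ := slice 0 (X * F)

lemma shiftSlice_cube_mul (H F : ℤ⟦X⟧) : shiftSlice (cube H * F) = H * shiftSlice F := by
  rw [shiftSlice, mul_left_comm, slice_cube_mul (by norm_num), shiftSlice]

lemma shiftSlice_eulerInv_mul (F : ℤ⟦X⟧) :
    shiftSlice (eulerInv ^ 3 * F) = cube eulerInv ^ 3 * slice 0 (etaNine * F) := by
  rw [shiftSlice, ← mul_assoc, etaNine_mul_inv, mul_assoc, slice_cube_mul (by norm_num)]

lemma coeff_shiftSlice {m N : ℕ} (h : N + 1 = 3 * m) (F : ℤ⟦X⟧) :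
    coeff m (shiftSlice F) = coeff N F := by
  rw [shiftSlice, coeff_slice, add_zero, ← h, coeff_succ_X_mul]

/-- The series `∑ a (9 * n - 3) X ^ n` attached to `∑ a n X ^ n`. -/
noncomputable def shiftSliceZero (F : ℤ⟦X⟧) : ℤ⟦X⟧ := shiftSlice (slice 0 F)

/-- The series `∑ a (9 * n - 2) X ^ n` attached to `∑ a n X ^ n`. -/
noncomputable def shiftSliceOne (F : ℤ⟦X⟧) : ℤ⟦X⟧ := shiftSlice (slice 1 F)

lemma shiftSliceZero_iterate (α : ℕ) (H : ℤ⟦X⟧) : ∃ P ∈ oddSpan (3 * α + 2),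
    shiftSliceZero^[α] (shiftSlice (cube^[2 * α + 1] H * eulerInv ^ 3)) =
      H * cube eulerInv ^ 3 * P := by
  induction α generalizing H with
  | zero =>
    refine ⟨9 * etaThree, ?_, ?_⟩
    · have := pow_mul_etaThree_pow_mem (J := {j | 1 ≤ j})
        (φ := fun j => 2 + (9 * j - 9) / 2) (e := 2) (j := 1) (by simp) (by simp)
      norm_num at this
      exact this
    · have h := shiftSlice_eulerInv_mul 1
      rw [mul_one, mul_one, slice_zero_etaNine] at h
      rw [Function.iterate_zero, id, Nat.mul_zero, zero_add, Function.iterate_one,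
        shiftSlice_cube_mul, h, mul_assoc]
  | succ α ih =>
    obtain ⟨P, hP, h⟩ := ih (cube (cube H))
    refine ⟨slice 0 (etaNine * slice 0 P), ?_, ?_⟩
    · exact slice_zero_etaNine_mul_mem_oddSpan (slice_zero_mem_evenSpan hP)
    · rw [show 2 * (α + 1) + 1 = 2 * α + 1 + 1 + 1 by ring,
        Function.iterate_succ_apply cube, Function.iterate_succ_apply cube,
        Function.iterate_succ_apply', h, shiftSliceZero,
        ← map_pow, ← map_mul, slice_cube_mul (by norm_num), mul_assoc, shiftSlice_cube_mul,
        shiftSlice_eulerInv_mul, map_pow, mul_assoc]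

lemma shiftSliceOne_iterate (β : ℕ) {c : ℕ} {P : ℤ⟦X⟧} (hP : P ∈ oddSpan c) :
    ∃ Q ∈ oddSpan (c + 2 * β), shiftSliceOne^[β] (euler ^ 3 * cube eulerInv ^ 3 * P) =
      euler ^ 3 * cube eulerInv ^ 3 * Q := by
  induction β with
  | zero => exact ⟨P, hP, rfl⟩
  | succ β ih =>
    obtain ⟨Q, hQ, h⟩ := ih
    obtain ⟨G, hG, h1⟩ := slice_one_mem_unitSpan hQ
    refine ⟨slice 0 (etaNine * G), slice_zero_etaNine_mul_mem_oddSpan_of_unitSpan hG, ?_⟩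
    rw [Function.iterate_succ_apply', h, shiftSliceOne, h1, ← map_pow, mul_assoc,
      shiftSlice_cube_mul, shiftSlice_eulerInv_mul, mul_assoc]

lemma coeff_shiftSliceZero_iterate (α : ℕ) {m N : ℕ} (hm : 1 ≤ m)
    (h : 8 * N + 3 * 9 ^ α = 8 * 9 ^ α * m + 3) (F : ℤ⟦X⟧) :
    coeff m (shiftSliceZero^[α] F) = coeff N F := by
  induction α generalizing m with
  | zero => rw [show m = N by omega]; rfl
  | succ α ih =>
    rw [Function.iterate_succ_apply', shiftSliceZero,
      coeff_shiftSlice (N := 3 * m - 1) (by omega), coeff_slice]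
    refine ih (by omega) ?_
    obtain ⟨m, rfl⟩ := Nat.exists_eq_add_of_le' hm
    rw [show 3 * (3 * (m + 1) - 1) + 0 = 9 * m + 6 by omega]
    rw [pow_succ] at h
    nlinarith

lemma coeff_shiftSliceOne_iterate (β : ℕ) {m N : ℕ} (hm : 1 ≤ m)
    (h : 4 * N + 9 ^ β = 4 * 9 ^ β * m + 1) (F : ℤ⟦X⟧) :
    coeff m (shiftSliceOne^[β] F) = coeff N F := by
  induction β generalizing m with
  | zero => rw [show m = N by omega]; rfl
  | succ β ih =>
    rw [Function.iterate_succ_apply', shiftSliceOne,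
      coeff_shiftSlice (N := 3 * m - 1) (by omega), coeff_slice]
    refine ih (by omega) ?_
    obtain ⟨m, rfl⟩ := Nat.exists_eq_add_of_le' hm
    rw [show 3 * (3 * (m + 1) - 1) + 1 = 9 * m + 7 by omega]
    rw [pow_succ] at h
    nlinarith

lemma exists_nine_pow_eq (n : ℕ) : ∃ b, 9 ^ n = 8 * b + 1 := by
  induction n with
  | zero => exact ⟨0, rfl⟩
  | succ n ih =>
    obtain ⟨b, hb⟩ := ih
    exact ⟨9 * b + 1, by rw [pow_succ, hb]; ring⟩

/-- The hypothesis is the progression of the first congruence, cleared of subtraction and of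
division by 8. -/
lemma coeff_iterate (α β n N : ℕ)
    (h : 8 * N + 3 * 9 ^ α = 6 * 9 ^ α * 9 ^ β * (4 * n + 3) + 1) (F : ℤ⟦X⟧) :
    coeff (n + 1) (shiftSliceOne^[β] (shiftSliceZero^[α] (shiftSlice F))) = coeff N F := by
  obtain ⟨a, ha⟩ := exists_nine_pow_eq α
  obtain ⟨b, hb⟩ := exists_nine_pow_eq β
  obtain ⟨k, hk⟩ : ∃ k, k = 8 * b * n + 6 * b + n := ⟨_, rfl⟩
  rw [coeff_shiftSliceOne_iterate β (N := k + 1) (by omega) (by rw [hb, hk]; ring),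
    coeff_shiftSliceZero_iterate α (N := 8 * a * k + 5 * a + k + 1) (by omega)
      (by rw [ha]; ring)]
  refine coeff_shiftSlice ?_ F
  rw [ha, hb] at h
  have h2 : 8 * (N + 1) = 8 * (3 * (8 * a * k + 5 * a + k + 1)) := by
    rw [hk]
    linarith
  exact Nat.eq_of_mul_eq_mul_left (by norm_num) h2

/-! ### The generating function of regular partition triples -/

open scoped PowerSeries.WithPiTopology in
lemma continuous_expand {p : ℕ} (hp : p ≠ 0) :
    Continuous (expand p hp : ℤ⟦X⟧ →ₐ[ℤ] ℤ⟦X⟧) := by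
  rw [continuous_iff_continuousAt]
  intro F
  rw [ContinuousAt, WithPiTopology.tendsto_iff_coeff_tendsto]
  intro d
  simp only [coeff_expand]
  split_ifs
  · exact (WithPiTopology.continuous_coeff ℤ (d / p)).tendsto F
  · exact tendsto_const_nhds

open scoped PowerSeries.WithPiTopology in
lemma expand_euler {p : ℕ} (hp : p ≠ 0) :
    expand p hp euler = ∏' i : ℕ, (1 - X ^ ((i + 1) * p)) := by
  rw [euler, (WithPiTopology.multipliable_one_sub_X_pow ℤ).map_tprod _ (continuous_expand hp)]
  refine tprod_congr fun i => ?_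
  rw [map_sub, map_one, map_pow, expand_X, ← pow_mul, mul_comm]

/-- The generating function of `ℓ`-regular partitions. -/
noncomputable def regularSeries (ℓ : ℕ) : ℤ⟦X⟧ :=
  PowerSeries.mk fun n => ((Nat.Partition.restricted n (¬ ℓ ∣ ·)).card : ℤ)

open scoped PowerSeries.WithPiTopology in
lemma regularSeries_mul_euler {ℓ : ℕ} (hℓ : ℓ ≠ 0) :
    regularSeries ℓ * euler = expand ℓ hℓ euler := by
  rw [expand_euler, regularSeries,
    Nat.Partition.powerSeriesMk_card_restricted_eq_tprod ℤ (¬ ℓ ∣ ·), euler,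
    ← (Nat.Partition.multipliable_powerSeriesMk_card_restricted ℤ (¬ ℓ ∣ ·)).tprod_mul
    (WithPiTopology.multipliable_one_sub_X_pow _)]
  simp_rw [ite_not, ite_mul, pow_mul]
  conv_lhs =>
    enter [1, b]
    rw [WithPiTopology.tsum_pow_mul_one_sub_of_constantCoeff_eq_zero (by simp)]
  -- Geometric series cancel the factors with ℓ ∤ i + 1; the survivors are reindexed by multiples of
  -- ℓ, shifted by one because indices start at 0.
  refine tprod_eq_tprod_of_ne_one_bij (fun i ↦ (i.val + 1) * ℓ - 1) ?_ ?_ ?_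
  · intro a b h
    have := Nat.pos_of_ne_zero hℓ
    rw [tsub_left_inj (by nlinarith) (by nlinarith), mul_left_inj' hℓ, add_left_inj] at h
    exact SetCoe.ext h
  · suffices ∀ (i : ℕ), ℓ ∣ i + 1 → ∃ j ≠ 0, j * ℓ - 1 = i by simpa
    intro i hi
    obtain ⟨j, hj⟩ := dvd_def.mp hi
    refine ⟨j, by grind, Nat.sub_eq_of_eq_add ?_⟩
    rw [hj, mul_comm ℓ j]
  · intro i
    have : (i + 1) * ℓ - 1 + 1 = (i + 1) * ℓ := by grind
    simp [this, pow_mul]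

lemma coeff_regularSeries_pow_three (ℓ n : ℕ) :
    coeff n (regularSeries ℓ ^ 3) = (T ℓ n : ℤ) := by
  have h : regularSeries ℓ ^ 3 = ∏ _j : Fin 3, regularSeries ℓ := by simp
  rw [h, coeff_prod, T, regularPartitionTriples, Finset.card_sigma, Nat.cast_sum]
  refine Finset.sum_nbij' (fun l => ⇑l) Finsupp.equivFunOnFinite.symm ?_ ?_ ?_ ?_ ?_
  · intro l hl
    rw [Finset.mem_finsuppAntidiag] at hl
    exact Finset.Nat.mem_antidiagonalTuple.2 hl.1
  · intro s hs
    rw [Finset.mem_finsuppAntidiag]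
    exact ⟨Finset.Nat.mem_antidiagonalTuple.1 hs, Finset.subset_univ _⟩
  · intro l _
    ext i
    rfl
  · intro s _
    rfl
  · intro l _
    rw [Fintype.card_piFinset, Nat.cast_prod]
    exact Finset.prod_congr rfl fun i _ => by rw [regularSeries, coeff_mk]

lemma expand_eq_cube_iterate (k : ℕ) (h : 3 ^ k ≠ 0) (F : ℤ⟦X⟧) :
    expand (3 ^ k) h F = cube^[k] F := by
  induction k with
  | zero => exact expand_one_apply F
  | succ k ih =>
    rw [Function.iterate_succ_apply', ← ih (pow_ne_zero _ three_ne_zero), cube,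
      ← expand_mul 3 three_ne_zero]
    simp only [pow_succ']

/-- The generating function of `3 ^ k`-regular partition triples is `f(q ^ 3 ^ k) ^ 3 / f(q) ^ 3`. -/
lemma coeff_cube_iterate_mul_eulerInv (k n : ℕ) :
    coeff n (cube^[k] (euler ^ 3) * eulerInv ^ 3) = (T (3 ^ k) n : ℤ) := by
  have h0 : 3 ^ k ≠ 0 := pow_ne_zero _ three_ne_zero
  have h := regularSeries_mul_euler h0
  rw [← coeff_regularSeries_pow_three, ← expand_eq_cube_iterate k h0, map_pow, ← h]
  congr 1
  linear_combination regularSeries (3 ^ k) ^ 3 * (euler ^ 2 * eulerInv ^ 2 + euler * eulerInv + 1)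
    * euler_mul_eulerInv

/-! ### Residues of the leading terms -/

lemma three_pow_dvd_iff (c : ℕ) (F : ℤ⟦X⟧) :
    (3 ^ c : ℤ⟦X⟧) ∣ F ↔ ∀ n, (3 ^ c : ℤ) ∣ coeff n F := by
  have h : (3 ^ c : ℤ⟦X⟧) = C (3 ^ c : ℤ) := by rw [map_pow, map_ofNat]
  constructor
  · rintro ⟨G, rfl⟩ n
    rw [h, coeff_C_mul]
    exact Dvd.intro _ rfl
  · intro hF
    choose G hG using hF
    refine ⟨PowerSeries.mk G, ?_⟩
    ext n
    rw [hG, h, coeff_C_mul, coeff_mk]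

/-- Reduction modulo three is compatible with the Frobenius endomorphism. -/
lemma three_dvd_cube_sub (F : ℤ⟦X⟧) : (3 : ℤ⟦X⟧) ∣ cube F - F ^ 3 := by
  have h0 : map (Int.castRingHom (ZMod 3)) (cube F - F ^ 3) = 0 := by
    have h1 := MvPowerSeries.map_frobenius_expand (R := ZMod 3) 3 three_ne_zero
      (f := (map (Int.castRingHom (ZMod 3)) F : MvPowerSeries Unit (ZMod 3)))
    have h2 : frobenius (ZMod 3) 3 = RingHom.id _ := ZMod.frobenius_zmod 3
    rw [h2, MvPowerSeries.map_id] at h1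
    rw [map_sub, map_pow, cube, map_expand, sub_eq_zero]
    exact h1
  have h3 := (three_pow_dvd_iff 1 (cube F - F ^ 3)).2 fun n => by
    have := congrArg (coeff n) h0
    rw [coeff_map, map_zero] at this
    rw [pow_one]
    exact_mod_cast (ZMod.intCast_zmod_eq_zero_iff_dvd _ 3).1 this
  rwa [pow_one] at h3

lemma eulerInv_pow_nine_eq : eulerInv ^ 9 =
    cube (cube euler ^ 3 * eulerInv ^ 12) * (1 + 9 * etaNine + 27 * etaNine ^ 2) := by
  rw [one_add_etaNine]
  linear_combination eulerInv ^ 6 * eulerInv_pow_three_eq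

lemma slice_eulerInv_pow_nine {r : ℕ} (hr : r < 3) (h0 : r ≠ 0) :
    slice r (eulerInv ^ 9) = cube euler ^ 3 * eulerInv ^ 12 *
      (9 * slice r etaNine + 27 * slice r (etaNine ^ 2)) := by
  have h1 : slice r (1 : ℤ⟦X⟧) = 0 := by
    have h := slice_sum_cube hr 1 0 0
    rw [if_neg h0, ite_self] at h
    simpa using h
  have e : (1 + 9 * etaNine + 27 * etaNine ^ 2 : ℤ⟦X⟧) =
      1 + 3 ^ 2 * etaNine + 3 ^ 3 * etaNine ^ 2 := by norm_num
  rw [eulerInv_pow_nine_eq, slice_cube_mul hr, e, map_add, map_add, h1, slice_pow_mul hr,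
    slice_pow_mul hr]
  norm_num

lemma nine_dvd_slice_one : (3 ^ 2 : ℤ⟦X⟧) ∣ slice 1 (eulerInv ^ 9) := by
  rw [slice_eulerInv_pow_nine (by norm_num) (by norm_num)]
  exact ⟨cube euler ^ 3 * eulerInv ^ 12 * (slice 1 etaNine + 3 * slice 1 (etaNine ^ 2)), by ring⟩

lemma twentySeven_dvd_slice_two : (3 ^ 3 : ℤ⟦X⟧) ∣ slice 2 (eulerInv ^ 9) := by
  rw [slice_eulerInv_pow_nine (by norm_num) (by norm_num), slice_two_etaNine]
  exact ⟨cube euler ^ 3 * eulerInv ^ 12 * (cube euler ^ 9 * eulerInv ^ 12 * eulerCubeSlice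
    + slice 2 (etaNine ^ 2)), by ring⟩

lemma exists_leading_term {J : Set ℕ} {φ : ℕ → ℕ} {F : ℤ⟦X⟧} (j₀ d : ℕ)
    (hφ : ∀ j ∈ J, j ≠ j₀ → d ≤ φ j) (hF : F ∈ weightedSpan J φ) :
    ∃ a : ℤ, (3 ^ d : ℤ⟦X⟧) ∣ F - a * 3 ^ φ j₀ * etaThree ^ j₀ := by
  induction hF using Submodule.span_induction with
  | mem x hx =>
    obtain ⟨j, hj, rfl⟩ := hx
    by_cases h : j = j₀
    · exact ⟨1, by simp [h]⟩
    · refine ⟨0, ?_⟩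
      simpa using (pow_dvd_pow (3 : ℤ⟦X⟧) (hφ j hj h)).mul_right (etaThree ^ j)
  | zero => exact ⟨0, by simp⟩
  | add x y _ _ hx hy =>
    obtain ⟨a, ha⟩ := hx
    obtain ⟨b, hb⟩ := hy
    refine ⟨a + b, ?_⟩
    convert! dvd_add ha hb using 1
    push_cast
    ring
  | smul c x _ hx =>
    obtain ⟨a, ha⟩ := hx
    refine ⟨c * a, ?_⟩
    convert! ha.mul_left (c : ℤ⟦X⟧) using 1
    rw [zsmul_eq_mul]
    push_cast
    ring

lemma dvd_of_mem_oddSpan {c : ℕ} {F : ℤ⟦X⟧} (hF : F ∈ oddSpan c) : (3 ^ c : ℤ⟦X⟧) ∣ F := by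
  -- Index 0 lies outside the span; truncated subtraction gives it exponent c, so its term is
  -- divisible by 3^c anyway.
  obtain ⟨a, ha⟩ := exists_leading_term 0 c (fun j _ _ => by omega) hF
  have h : (3 ^ c : ℤ⟦X⟧) ∣ a * 3 ^ (c + (9 * 0 - 9) / 2) * etaThree ^ 0 :=
    Dvd.intro_left (a : ℤ⟦X⟧) (by simp)
  exact (dvd_sub_left h).1 ha

lemma leading_term_oddSpan {c : ℕ} {F : ℤ⟦X⟧} (hF : F ∈ oddSpan c) :
    ∃ a : ℤ, (3 ^ (c + 4) : ℤ⟦X⟧) ∣ F - a * 3 ^ c * etaThree := by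
  obtain ⟨a, ha⟩ := exists_leading_term 1 (c + 4)
    (fun j (hj : 1 ≤ j) hj1 => by omega) hF
  exact ⟨a, by simpa using ha⟩

lemma leading_term_unitSpan {c : ℕ} {F : ℤ⟦X⟧} (hF : F ∈ unitSpan c) :
    ∃ a : ℤ, (3 ^ (c + 4) : ℤ⟦X⟧) ∣ F - a * 3 ^ c := by
  obtain ⟨a, ha⟩ := exists_leading_term 0 (c + 4)
    (fun j _ hj => by omega) hF
  exact ⟨a, by simpa using ha⟩

lemma dvd_slice_of_mem_oddSpan {c e r : ℕ} (hr : r < 3) (he : e ≤ 4)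
    (hg : (3 ^ e : ℤ⟦X⟧) ∣ slice r (eulerInv ^ 9)) {F : ℤ⟦X⟧} (hF : F ∈ oddSpan c) (n : ℕ) :
    (3 ^ (c + e) : ℤ) ∣ coeff (3 * n + r + 1) (euler ^ 3 * cube eulerInv ^ 3 * F) := by
  obtain ⟨a, G, hG⟩ := leading_term_oddSpan hF
  have h : euler ^ 3 * cube eulerInv ^ 3 * F =
      X * (3 ^ c * ((a : ℤ⟦X⟧) * (cube (euler ^ 9) * eulerInv ^ 9)))
      + 3 ^ (c + e) * (3 ^ (4 - e) * (euler ^ 3 * cube eulerInv ^ 3 * G)) := by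
    have h4 : (3 : ℤ⟦X⟧) ^ (c + 4) = 3 ^ (c + e) * 3 ^ (4 - e) := by
      rw [← pow_add]
      congr 1
      omega
    rw [sub_eq_iff_eq_add.1 hG, h4, etaThree, map_pow]
    linear_combination a * 3 ^ c * X * cube euler ^ 9 * eulerInv ^ 9 *
      (euler_pow_mul_eulerInv_pow 3 + euler ^ 3 * eulerInv ^ 3 *
        cube_euler_pow_mul_eulerInv_pow 3)
  rw [h, map_add, coeff_succ_X_mul]
  refine dvd_add ?_ ((three_pow_dvd_iff _ _).1 (Dvd.intro _ rfl) _)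
  rw [← coeff_slice, slice_pow_mul hr]
  refine (three_pow_dvd_iff _ _).1 ?_ n
  rw [pow_add]
  refine mul_dvd_mul_left _ ?_
  have h5 : (a : ℤ⟦X⟧) * (cube (euler ^ 9) * eulerInv ^ 9) =
      cube (a * euler ^ 9) * eulerInv ^ 9 := by
    rw [map_mul, map_intCast]
    ring
  rw [h5, slice_cube_mul hr]
  exact hg.mul_left _

/-- Jacobi's identity applied to both factors f^3, with 8 T_k + 1 = (2k + 1)^2. -/
lemma coeff_euler_pow_six_eq_zero {m : ℕ} (h : ¬ ∃ x y : ℕ, 8 * m + 2 = x ^ 2 + y ^ 2) :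
    coeff m (euler ^ 6) = 0 := by
  rw [show 6 = 3 + 3 by rfl, pow_add, coeff_mul]
  refine Finset.sum_eq_zero fun ij hij => ?_
  rw [Finset.HasAntidiagonal.mem_antidiagonal] at hij
  by_contra hne
  obtain ⟨k, hk⟩ := exists_of_coeff_euler_pow_three_ne_zero (left_ne_zero_of_mul hne)
  obtain ⟨l, hl⟩ := exists_of_coeff_euler_pow_three_ne_zero (right_ne_zero_of_mul hne)
  refine h ⟨2 * k + 1, 2 * l + 1, ?_⟩
  have h1 := two_mul_triangular k
  have h2 := two_mul_triangular l
  rw [← hij, ← hk, ← hl]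
  linarith

lemma dvd_slice_one_of_mem_oddSpan {c m : ℕ} (hm : ¬ ∃ x y : ℕ, 8 * m + 2 = x ^ 2 + y ^ 2)
    {F : ℤ⟦X⟧} (hF : F ∈ oddSpan c) :
    (3 ^ (c + 2) : ℤ) ∣ coeff (3 * m + 1) (euler ^ 3 * cube eulerInv ^ 3 * F) := by
  obtain ⟨G, hG, h⟩ := slice_one_mem_unitSpan hF
  obtain ⟨a, K, hK⟩ := leading_term_unitSpan hG
  obtain ⟨W, hW⟩ := three_dvd_cube_sub euler
  rw [← coeff_slice, h, sub_eq_iff_eq_add.1 hK]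
  -- Cubing f(q^3) = f^3 + 3W gives f(q^3)^3 ≡ f^9 mod 9, hence f(q^3)^3 / f^3 ≡ f^6 mod 9.
  have h1 : cube euler ^ 3 * eulerInv ^ 3 * (3 ^ (c + 4) * K + a * 3 ^ c) =
      C (a * 3 ^ c) * euler ^ 6 + 3 ^ (c + 2) * (9 * cube euler ^ 3 * eulerInv ^ 3 * K
        + a * eulerInv ^ 3 * (euler ^ 6 * W + 3 * euler ^ 3 * W ^ 2 + 3 * W ^ 3)) := by
    have hC : (C (a * 3 ^ c) : ℤ⟦X⟧) = a * 3 ^ c := by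
      rw [map_mul, map_pow, map_ofNat]
      simp
    have h3 := euler_pow_mul_eulerInv_pow 3
    rw [hC, sub_eq_iff_eq_add.1 hW, pow_add, pow_add]
    linear_combination a * 3 ^ c * euler ^ 6 * h3
  rw [h1, map_add, coeff_C_mul, coeff_euler_pow_six_eq_zero hm, mul_zero, zero_add]
  exact (three_pow_dvd_iff _ _).1 (Dvd.intro _ rfl) _

/-! ### Assembly of the four congruences. -/

lemma exists_T_eq_coeff (α β : ℕ) : ∃ F ∈ oddSpan (3 * α + 2 * β + 2), ∀ n N : ℕ,
    8 * N + 3 * 9 ^ α = 6 * 9 ^ α * 9 ^ β * (4 * n + 3) + 1 →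
    (T (3 ^ (2 * α + 1)) N : ℤ) = coeff (n + 1) (euler ^ 3 * cube eulerInv ^ 3 * F) := by
  obtain ⟨P, hP, h⟩ := shiftSliceZero_iterate α (euler ^ 3)
  obtain ⟨Q, hQ, h'⟩ := shiftSliceOne_iterate β hP
  rw [show 3 * α + 2 + 2 * β = 3 * α + 2 * β + 2 by ring] at hQ
  refine ⟨Q, hQ, fun n N hN => ?_⟩
  rw [← h', ← h, coeff_iterate α β n N hN, coeff_cube_iterate_mul_eulerInv]

/-- Here 8m + 2 = 2 p^(2k+1) (4n + p) has p-adic valuation exactly 2k + 1, which is odd. -/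
lemma not_exists_sq_add_sq {p k n m : ℕ} (hp : p.Prime) (hp4 : p ≡ 3 [MOD 4]) (hn : ¬ p ∣ n)
    (hm : 4 * m + 1 = p ^ (2 * k + 1) * (4 * n + p)) :
    ¬ ∃ x y : ℕ, 8 * m + 2 = x ^ 2 + y ^ 2 := by
  have hmod : p % 4 = 3 := hp4
  have : Fact p.Prime := ⟨hp⟩
  have h2 : ¬ p ∣ 2 := fun h => by
    have := Nat.le_of_dvd (by norm_num) h
    have : p = 2 := le_antisymm this hp.two_le
    omega
  have h4 : ¬ p ∣ 4 * n + p := fun h => by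
    have h1 : p ∣ 2 * 2 * n := (Nat.dvd_add_left dvd_rfl).1 h
    rcases hp.dvd_mul.1 h1 with h1 | h1
    · rcases hp.dvd_mul.1 h1 with h1 | h1 <;> exact h2 h1
    · exact hn h1
  have e : 8 * m + 2 = 2 * (p ^ (2 * k + 1) * (4 * n + p)) := by rw [← hm]; ring
  intro h
  have hdvd : p ∣ 8 * m + 2 := by
    rw [e]
    exact ((dvd_pow_self p (by omega)).mul_right _).mul_left _
  have h5 := Nat.eq_sq_add_sq_iff.1 h p (Nat.mem_primeFactors.2 ⟨hp, hdvd, by omega⟩) hmod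
  have hpos := hp.pos
  rw [e, padicValNat.mul (by norm_num) (by positivity), padicValNat.mul (by positivity)
    (by omega), padicValNat.prime_pow, padicValNat.eq_zero_of_not_dvd h2,
    padicValNat.eq_zero_of_not_dvd h4] at h5
  exact (Nat.not_even_iff_odd.2 ⟨k, by ring⟩) h5

theorem theorem1p1 (α β : ℕ) :
    (∀ n : ℕ,
      T (3 ^ (2 * α + 1))
          (3 ^ (2 * α + 2 * β + 1) * n
            + (2 * 3 ^ (2 * α + 2 * β + 2) - 3 ^ (2 * α + 1) + 1) / 8)
        ≡ 0 [MOD 3 ^ (3 * α + 2 * β + 2)]) ∧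
    (∀ n : ℕ,
      T (3 ^ (2 * α + 1))
          (3 ^ (2 * α + 2 * β + 2) * n
            + (14 * 3 ^ (2 * α + 2 * β + 1) - 3 ^ (2 * α + 1) + 1) / 8)
        ≡ 0 [MOD 3 ^ (3 * α + 2 * β + 4)]) ∧
    (∀ n : ℕ,
      T (3 ^ (2 * α + 1))
          (3 ^ (2 * α + 2 * β + 2) * n
            + (22 * 3 ^ (2 * α + 2 * β + 1) - 3 ^ (2 * α + 1) + 1) / 8)
        ≡ 0 [MOD 3 ^ (3 * α + 2 * β + 5)]) ∧
    (∀ n k p : ℕ, p.Prime → p ≡ 3 [MOD 4] → ¬ p ∣ n →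
      T (3 ^ (2 * α + 1))
          (3 ^ (2 * α + 2 * β + 2) * p ^ (2 * k + 1) * n
            + (2 * p ^ (2 * k + 2) * 3 ^ (2 * α + 2 * β + 2) - 3 ^ (2 * α + 1) + 1) / 8)
        ≡ 0 [MOD 3 ^ (3 * α + 2 * β + 4)]) := by
  obtain ⟨F, hF, hT⟩ := exists_T_eq_coeff α β
  obtain ⟨a, ha⟩ := exists_nine_pow_eq α
  obtain ⟨c, hc⟩ := exists_nine_pow_eq (α + β)
  have hle : 9 ^ α ≤ 9 ^ (α + β) := Nat.pow_le_pow_right (by norm_num) (by omega)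
  have e1 : 3 ^ (2 * α + 1) = 3 * 9 ^ α := by rw [pow_succ, pow_mul]; ring
  have e2 : 3 ^ (2 * α + 2 * β + 1) = 3 * 9 ^ (α + β) := by
    rw [pow_succ, ← mul_add, pow_mul]; ring
  have e3 : 3 ^ (2 * α + 2 * β + 2) = 9 * 9 ^ (α + β) := by
    rw [pow_succ, e2]; ring
  have key : ∀ n N d : ℕ, (3 ^ d : ℤ) ∣ coeff (n + 1) (euler ^ 3 * cube eulerInv ^ 3 * F) →
      8 * N + 3 * 9 ^ α = 6 * (9 ^ (α + β) * (4 * n + 3)) + 1 →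
      T (3 ^ (2 * α + 1)) N ≡ 0 [MOD 3 ^ d] := fun n N d hd hN => by
    rw [Nat.modEq_zero_iff_dvd]
    rw [← hT n N (by rw [hN, pow_add]; ring)] at hd
    exact_mod_cast hd
  refine ⟨fun n => ?_, fun n => ?_, fun n => ?_, fun n k p hp hp4 hn => ?_⟩
  · refine key n _ _ ((three_pow_dvd_iff _ _).1 ((dvd_of_mem_oddSpan hF).mul_left _) _) ?_
    rw [e1, e2, e3, show 9 ^ (α + β) * (4 * n + 3) =
      4 * (9 ^ (α + β) * n) + 3 * 9 ^ (α + β) by ring, mul_assoc]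
    generalize 9 ^ (α + β) * n = v
    -- `ha` and `hc` make the division by 8 exact, and `hle` keeps the subtraction from truncating.
    omega
  · refine key (3 * n + 1) _ _ (dvd_slice_of_mem_oddSpan (by norm_num) (by norm_num)
      nine_dvd_slice_one hF n) ?_
    rw [e1, e2, e3, show 9 ^ (α + β) * (4 * (3 * n + 1) + 3) =
      12 * (9 ^ (α + β) * n) + 7 * 9 ^ (α + β) by ring, mul_assoc]
    generalize 9 ^ (α + β) * n = v
    omega
  · refine key (3 * n + 2) _ _ (dvd_slice_of_mem_oddSpan (by norm_num) (by norm_num)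
      twentySeven_dvd_slice_two hF n) ?_
    rw [e1, e2, e3, show 9 ^ (α + β) * (4 * (3 * n + 2) + 3) =
      12 * (9 ^ (α + β) * n) + 11 * 9 ^ (α + β) by ring, mul_assoc]
    generalize 9 ^ (α + β) * n = v
    omega
  · obtain ⟨r, hr⟩ : ∃ r, p ^ (2 * k + 2) = 8 * r + 1 := by
      have hodd : Odd (p ^ (k + 1)) := by
        have hmod : p % 4 = 3 := hp4
        exact Odd.pow (Nat.odd_iff.2 (by omega))
      obtain ⟨r, hr⟩ := Nat.eight_dvd_sq_sub_one_of_odd hodd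
      have hpos : 0 < (p ^ (k + 1)) ^ 2 := pow_pos hodd.pos 2
      exact ⟨r, by rw [show 2 * k + 2 = (k + 1) * 2 by ring, pow_mul]; omega⟩
    -- Chosen so that 4m + 1 = p^(2k+1) (4n + p); the target is then the first progression at index
    -- 3m.
    obtain ⟨m, hm⟩ : ∃ m, m = p ^ (2 * k + 1) * n + 2 * r := ⟨_, rfl⟩
    have hm' : 4 * m + 1 = p ^ (2 * k + 1) * (4 * n + p) := by
      have h := pow_succ p (2 * k + 1)
      rw [hr] at h
      rw [hm, mul_add, mul_add, ← h]
      ring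
    refine key (3 * m) _ _ (dvd_slice_one_of_mem_oddSpan
      (not_exists_sq_add_sq hp hp4 hn hm') hF) ?_
    rw [e1, e3, hr, show 9 ^ (α + β) * (4 * (3 * m) + 3) =
      12 * (9 ^ (α + β) * (p ^ (2 * k + 1) * n)) + 24 * (9 ^ (α + β) * r) + 3 * 9 ^ (α + β) by
        rw [hm]; ring, show 2 * (8 * r + 1) * (9 * 9 ^ (α + β)) =
      144 * (9 ^ (α + β) * r) + 18 * 9 ^ (α + β) by ring, mul_assoc, mul_assoc]
    generalize 9 ^ (α + β) * (p ^ (2 * k + 1) * n) = v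
    generalize 9 ^ (α + β) * r = w
    omega
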